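/- **Setting.** Let $\mathcal X,\mathcal U$ be finite nonempty sets, let $\mathcal P(S)$ be the set of probability vectors on a finite set $S$ with the $l_1$ distance, $\mathcal H=\{h:\mathcal X\to\mathcal P(\mathcal U)\}$, $\mathcal C=\mathcal P(\mathcal X)\times\mathcal H$, and $d_{\mathcal C}((\mu,h),(\mu',h'))=\|\mu-\mu'\|_1+\max_{x}\|h(x)-h'(x)\|_1$. Let $\gamma\in(0,1)$ and let $L_P,L_\Pi,\tilde R,L_{\tilde r}>0$ satisfy $\gamma(2L_P+1)(1+L_\Pi)<1$. Let $P(x,\mu,u,\nu)\in\mathcal P(\mathcal X)$ and $\tilde r(x,\mu,u,\nu)\in\mathbb R$ (for $x\in\mathcal X$, $\mu\in\mathcal P(\mathcal X)$, $u\in\mathcal U$, $\nu\in\mathcal P(\mathcal U)$) be such that $|\tilde r|\le\tilde R$ and, for all arguments, $$|\tilde r(x,\mu_1,u,\nu_1)-\tilde r(x,\mu_2,u,\nu_2)|\le L_{\tilde r}(\|\mu_1-\mu_2\|_1+\|\nu_1-\nu_2\|_1),$$ $$\|P(x,\mu_1,u,\nu_1)-P(x,\mu_2,u,\nu_2)\|_1\le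 L_P(\|\mu_1-\mu_2\|_1+\|\nu_1-\nu_2\|_1).$$ Put $\nu(\mu,h)=\sum_x\mu(x)h(x)$, $\Phi(\mu,h)=\sum_{x,u}P(x,\mu,u,\nu(\mu,h))\,\mu(x)h(x)(u)$, $r(\mu,h)=\sum_{x,u}\tilde r(x,\mu,u,\nu(\mu,h))\,\mu(x)h(x)(u)$, $L_r=\tilde R+2L_{\tilde r}$, $L_\Phi=2L_P+1$, $V_{\max}=\tilde R/(1-\gamma)$. *Kernel Q-learning.* Let $\epsilon>0$ and let $\mathcal C_\epsilon=\{c^1,\dots,c^{N_\epsilon}\}\subset\mathcal C$ be a finite $\epsilon$-net: every $c\in\mathcal C$ has some $c^i$ with $d_{\mathcal C}(c,c^i)<\epsilon$. Let $\mathcal H_\epsilon$ be the set of second components of the points of $\mathcal C_\epsilon$. Let $K:\mathcal C_\epsilon\times\mathcal C\to[0,\infty)$ satisfy $\sum_iK(c^i,c)=1$ for every $c$, $K(c^i,c)=0$ if $d_{\mathcal C}(c^i,c)>\epsilon$, $\#\{i:K(c^i,c)>0\}\le N_K$ for every $c$, and $|K(c^i,c')-K(c^i,c'')|\le L_K\,d_{\mathcal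 C}(c',c'')$ with $L_K>0$. Put $\Gamma_Kf(c)=\sum_iK(c^i,c)f(c^i)$. For each $i$ let $(\widehat r(c^i),\widehat\Phi(c^i))$ be the average of $(r(c),\Phi(c))$ over finitely many (at least one) sample points $c$ with $d_{\mathcal C}(c^i,c)<\epsilon$, and let $$(\widehat B_\epsilon q)(c^i)=\widehat r(c^i)+\gamma\max_{h\in\mathcal H_\epsilon}\Gamma_Kq(\widehat\Phi(c^i),h),\qquad q:\mathcal C_\epsilon\to\mathbb R.$$ *$N$ agents.* Let $\Pi$ be the set of sequences $\pi=(\pi_t)_{t\ge0}$ of measurable maps $\pi_t:\mathcal P(\mathcal X)\to\mathcal H$, and let $\Pi_{L_\Pi}\subseteq\Pi$ be the set of those with $\|\pi_t(\mu_1)(x)-\pi_t(\mu_2)(x)\|_1\le L_\Pi\|\mu_1-\mu_2\|_1$ for all $t,x,\mu_1,\mu_2$. For $N\ge1$ and profiles $\boldsymbol x\in\mathcal X^N$, $\boldsymbol u\in\mathcal U^N$, let $$Q_N^\pi(\boldsymbol x,\boldsymbol u)=\mathbb E\Big[\sum_{t=0}^\infty\gamma^t\,\frac1N\sum_{j=1}^N\tilde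 r(x_t^j,\mu_t^N,u_t^j,\nu_t^N)\Big],$$ where $(\boldsymbol x_0,\boldsymbol u_0)=(\boldsymbol x,\boldsymbol u)$, $\mu_t^N$ and $\nu_t^N$ are the empirical distributions of $\boldsymbol x_t$ and $\boldsymbol u_t$, and, independently over the agents $j$ given the past, $x_{t+1}^j\sim P(x_t^j,\mu_t^N,u_t^j,\nu_t^N)$ for $t\ge0$ and $u_t^j\sim\pi_t(\mu_t^N)(x_t^j)$ for $t\ge1$. Let $Q_N=\sup_{\pi\in\mathcal A}Q_N^\pi$, where $\mathcal A$ is any class of policies with $\Pi_{L_\Pi}\subseteq\mathcal A\subseteq\Pi$ (for instance $\mathcal A=\Pi_{L_\Pi}$ or $\mathcal A=\Pi$). Let $\mu^N$ be the empirical distribution of $\boldsymbol x$, and let $h^N\in\mathcal H$ be such that $h^N(y)(a)=\#\{j:x^j=y,\,u^j=a\}/\#\{j:x^j=y\}$ for every state $y$ that occurs in $\boldsymbol x$ ($h^N(y)\in\mathcal P(\mathcal U)$ is arbitrary for the other states $y$). Regard $Q_N$ as a function of the pairs $(\mu^N,h^N)$ that arise in this way, $Q_N(\mu^N,h^N)=Q_N(\boldsymbol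 x,\boldsymbol u)$. **Theorem.** The operator $\widehat B_\epsilon$ has a unique fixed point $\widehat Q_\epsilon$ with $\|\widehat Q_\epsilon\|_\infty\le V_{\max}$, and for every $N\ge1$ $$\|Q_N-\Gamma_K\widehat Q_\epsilon\|_\infty\le\frac{L_r+2\gamma N_KL_KV_{\max}L_\Phi}{1-\gamma}\,\epsilon+\frac{2L_r}{(1-\gamma L_\Phi)(1-\gamma)}\,\epsilon+\frac{\widetilde C}{\sqrt N},$$ where the sup norm is over all pairs $(\mu^N,h^N)$ as above, and $\widetilde C=C_0\,(\sqrt{|\mathcal X|}+\sqrt{|\mathcal U|})$ with a constant $C_0>0$ that depends only on $L_P,L_\Pi,\tilde R,L_{\tilde r},\gamma$; in particular $\widetilde C$ does not depend on $N$ or $\epsilon$. -/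

import Mathlib

noncomputable section

namespace MFC

/-- Probability vectors on a finite set `S`. -/
abbrev Prob (S : Type*) [Fintype S] : Type _ := stdSimplex ℝ S

/-- The `l¹` distance between two probability vectors. -/
def l1dist {S : Type*} [Fintype S] (p q : Prob S) : ℝ := ∑ s, |p.1 s - q.1 s|

/-- `𝓗`: local policies, assigning to each state a randomized action. -/
abbrev LocalPolicy (X U : Type*) [Fintype U] : Type _ := X → Prob U

/-- `𝓒 = 𝓟(X) × 𝓗`, the lifted state-action space. -/
abbrev Lifted (X U : Type*) [Fintype X] [Fintype U] : Type _ := Prob X × LocalPolicy X U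

section MeanField

variable {X U : Type*} [Fintype X] [Fintype U]

/-- `d_𝓗(h, h') = max_x ‖h x - h' x‖₁`. -/
def distH (h h' : LocalPolicy X U) : ℝ := ⨆ x, l1dist (h x) (h' x)

/-- `d_𝓒((μ, h), (μ', h')) = ‖μ - μ'‖₁ + d_𝓗(h, h')`. -/
def distC (c c' : Lifted X U) : ℝ := l1dist c.1 c'.1 + distH c.2 c'.2

/-- Boundedness and Lipschitz continuity of the individual reward. -/
def RewardRegular (rt : X → Prob X → U → Prob U → ℝ) (R L : ℝ) : Prop :=
  (∀ x μ u ν, |rt x μ u ν| ≤ R) ∧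
  ∀ x u μ₁ μ₂ ν₁ ν₂,
    |rt x μ₁ u ν₁ - rt x μ₂ u ν₂| ≤ L * (l1dist μ₁ μ₂ + l1dist ν₁ ν₂)

/-- Lipschitz continuity of the transition probabilities. -/
def TransitionRegular (P : X → Prob X → U → Prob U → Prob X) (L : ℝ) : Prop :=
  ∀ x u μ₁ μ₂ ν₁ ν₂,
    l1dist (P x μ₁ u ν₁) (P x μ₂ u ν₂) ≤ L * (l1dist μ₁ μ₂ + l1dist ν₁ ν₂)

/-- The mixture `∑ₐ p(a) k(a)`: the law of a draw from `k a` where `a` is drawn from `p`. -/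
def mix {A B : Type*} [Fintype A] [Fintype B] (p : Prob A) (k : A → Prob B) : Prob B :=
  ⟨fun b => ∑ a, p.1 a * (k a).1 b,
    fun b => Finset.sum_nonneg fun a _ => mul_nonneg (p.2.1 a) ((k a).2.1 b), by
      rw [Finset.sum_comm]
      simp_rw [← Finset.mul_sum, (k _).2.2, mul_one]
      exact p.2.2⟩

/-- `ν(μ, h) = ∑ₓ μ(x) h(x)`, the action distribution of the population. -/
def actionDist (μ : Prob X) (h : LocalPolicy X U) : Prob U := mix μ h

/-- The aggregated dynamics `Φ(μ, h) = ∑ₓ ∑ᵤ P(x, μ, u, ν(μ, h)) μ(x) h(x)(u)`. -/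
def aggDynamics (P : X → Prob X → U → Prob U → Prob X) (c : Lifted X U) : Prob X :=
  mix c.1 fun x => mix (c.2 x) fun u => P x c.1 u (actionDist c.1 c.2)

/-- The aggregated reward `r(μ, h) = ∑ₓ ∑ᵤ r̃(x, μ, u, ν(μ, h)) μ(x) h(x)(u)`. -/
def aggReward (rt : X → Prob X → U → Prob U → ℝ) (c : Lifted X U) : ℝ :=
  ∑ x, ∑ u, rt x c.1 u (actionDist c.1 c.2) * c.1.1 x * (c.2 x).1 u

/-! ### The kernel-based algorithm -/

/-- `net` is an `ε`-net of `𝓒`. -/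
def IsNet (ε : ℝ) (net : Finset (Lifted X U)) : Prop :=
  ∀ c : Lifted X U, ∃ c' ∈ net, distC c c' < ε

/-- `𝓗_ε`: all the local policies occurring in the net. -/
def netH (net : Finset (Lifted X U)) : Set (LocalPolicy X U) := Prod.snd '' (net : Set (Lifted X U))

/-- A regression kernel on the net, at most `NK` of whose weights are positive at each point and
which is `LK`-Lipschitz in its second argument. -/
structure IsRegressionKernel (ε : ℝ) (net : Finset (Lifted X U)) (K : net → Lifted X U → ℝ)
    (NK : ℕ) (LK : ℝ) : Prop where
  nonneg : ∀ i c, 0 ≤ K i c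
  sum_eq_one : ∀ c, ∑ i, K i c = 1
  local_support : ∀ i c, ε < distC i.1 c → K i c = 0
  card_pos_le : ∀ c, Set.ncard {i : net | 0 < K i c} ≤ NK
  lipschitz : ∀ i c c', |K i c - K i c'| ≤ LK * distC c c'

/-- The kernel regression operator `Γ_K f(c) = ∑ᵢ K(cⁱ, c) f(cⁱ)`. -/
def kernelReg {net : Finset (Lifted X U)} (K : net → Lifted X U → ℝ) (f : net → ℝ)
    (c : Lifted X U) : ℝ :=
  ∑ i, K i c * f i

/-- The data `(r̂(c), Φ̂(c))` is sampled from the `ε`-neighborhood of `c`: it is the average of the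
observed pairs `(r(c'), Φ(c'))` over one or more sample points `c'` (repetitions allowed) with
`d_𝓒(c, c') < ε`. -/
def IsSampledFrom (P : X → Prob X → U → Prob U → Prob X) (rt : X → Prob X → U → Prob U → ℝ)
    (ε : ℝ) (c : Lifted X U) (rhat : ℝ) (Φhat : Prob X) : Prop :=
  ∃ (n : ℕ) (s : Fin (n + 1) → Lifted X U),
    (∀ k, distC c (s k) < ε) ∧
    rhat = (∑ k, aggReward rt (s k)) / (n + 1) ∧
    ∀ y, Φhat.1 y = (∑ k, (aggDynamics P (s k)).1 y) / (n + 1)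

/-- The Bellman operator with estimated data,
`(B̂ q)(cⁱ) = r̂(cⁱ) + γ max_{h ∈ 𝓗_ε} Γ_K q(Φ̂(cⁱ), h)`. The supremum is over a finite set. -/
def bellmanHat (γ : ℝ) {net : Finset (Lifted X U)} (K : net → Lifted X U → ℝ)
    (rhat : net → ℝ) (Φhat : net → Prob X) (q : net → ℝ) (i : net) : ℝ :=
  rhat i + γ * ⨆ h : netH net, kernelReg K q (Φhat i, h.1)

/-! ### Policies -/

/-- Time-dependent policies `π = (π_t)`, with `π_t : 𝓟(X) → 𝓗`. -/
abbrev Policy (X U : Type*) [Fintype X] [Fintype U] : Type _ := ℕ → Prob X → LocalPolicy X U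

/-- `Π`: the policies all of whose `π_t` are Borel measurable. -/
def admissible (X U : Type*) [Fintype X] [Fintype U] : Set (Policy X U) :=
  {π | ∀ t, Measurable (π t)}

/-- The admissible policies that are `L`-Lipschitz in the state distribution. -/
def lipAdmissible (X U : Type*) [Fintype X] [Fintype U] (L : ℝ) : Set (Policy X U) :=
  {π | π ∈ admissible X U ∧
    ∀ t x μ₁ μ₂, l1dist (π t μ₁ x) (π t μ₂ x) ≤ L * l1dist μ₁ μ₂}

end MeanField

/-! ### The system with `N` agents -/

section Agents

variable {X U : Type*} [Fintype X] [Fintype U] {N : ℕ} [NeZero N]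

open Classical in
/-- The empirical distribution `s ↦ #{j : y_j = s} / N` of a profile of `N` agents. -/
def empirical {S : Type*} [Fintype S] (y : Fin N → S) : Prob S :=
  ⟨fun s => (∑ j, if y j = s then (1 : ℝ) else 0) / N,
    fun s => div_nonneg (Finset.sum_nonneg fun j _ => by split_ifs <;> norm_num)
      (Nat.cast_nonneg N), by
      rw [← Finset.sum_div, Finset.sum_comm]
      simp [NeZero.ne N]⟩

/-- The law of `N` independent draws, the `j`-th one from `p j`. -/
def indep {S : Type*} [Fintype S] (p : Fin N → Prob S) : Prob (Fin N → S) :=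
  ⟨fun y => ∏ j, (p j).1 (y j), fun y => Finset.prod_nonneg fun j _ => (p j).2.1 (y j), by
    classical
    rw [← Fintype.piFinset_univ, ← Finset.prod_univ_sum]
    exact Finset.prod_eq_one fun j _ => (p j).2.2⟩

/-- The next state profile: `x'_j ∼ P(x_j, μᴺ, u_j, νᴺ)`, independently over the agents. -/
def nextState (P : X → Prob X → U → Prob U → Prob X) (x : Fin N → X) (u : Fin N → U) :
    Prob (Fin N → X) :=
  indep fun j => P (x j) (empirical x) (u j) (empirical u)

/-- The action profile: `u_j ∼ π(μᴺ, x_j)`, independently over the agents. -/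
def nextAction (π : Prob X → LocalPolicy X U) (x : Fin N → X) : Prob (Fin N → U) :=
  indep fun j => π (empirical x) (x j)

open Classical in
/-- The law of the state and action profiles `(x_t, u_t)` of the `N` agents at time `t` that start
with the states `x` and the actions `u` at time `0` and follow the policy `π` at times `t ≥ 1`. -/
def profileLaw (P : X → Prob X → U → Prob U → Prob X) (π : Policy X U)
    (x : Fin N → X) (u : Fin N → U) : ℕ → Prob ((Fin N → X) × (Fin N → U))
  | 0 => ⟨Pi.single (x, u) 1, single_mem_stdSimplex ℝ (x, u)⟩
  | t + 1 => mix (profileLaw P π x u t) fun s =>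
      mix (nextState P s.1 s.2) fun x' =>
        mix (nextAction (π (t + 1)) x') fun u' =>
          ⟨Pi.single (x', u') 1, single_mem_stdSimplex ℝ (x', u')⟩

/-- The average reward `N⁻¹ ∑_j r̃(x_j, μᴺ, u_j, νᴺ)` of the agents. -/
def avgReward (rt : X → Prob X → U → Prob U → ℝ) (x : Fin N → X) (u : Fin N → U) : ℝ :=
  (∑ j, rt (x j) (empirical x) (u j) (empirical u)) / N

/-- `Q_N^π`: the average reward now plus the expected discounted average rewards at the times
`t + 1`, `t ≥ 0`, from the initial states `x` and actions `u`, under `π`. -/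
def agentQpi (P : X → Prob X → U → Prob U → Prob X) (rt : X → Prob X → U → Prob U → ℝ) (γ : ℝ)
    (π : Policy X U) (x : Fin N → X) (u : Fin N → U) : ℝ :=
  avgReward rt x u +
    ∑' t : ℕ, γ ^ (t + 1) * ∑ s, (profileLaw P π x u (t + 1)).1 s * avgReward rt s.1 s.2

/-- `Q_N`: the supremum of `Q_N^π` over the policies `π` in the class `A`. -/
def agentQ (P : X → Prob X → U → Prob U → Prob X) (rt : X → Prob X → U → Prob U → ℝ) (γ : ℝ)
    (A : Set (Policy X U)) (x : Fin N → X) (u : Fin N → U) : ℝ :=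
  ⨆ π : A, agentQpi P rt γ π.1 x u

open Classical in
/-- `h` is the empirical local policy `hᴺ(y)(a) = #{j : x_j = y, u_j = a} / #{j : x_j = y}` of the
agents at all states `y` occupied by some agent. At the other states, where the quotient reads
`0 / 0`, it may be any probability vector. -/
def IsEmpiricalPolicy (x : Fin N → X) (u : Fin N → U) (h : LocalPolicy X U) : Prop :=
  ∀ y, (∃ j, x j = y) → ∀ a,
    (h y).1 a = (∑ j, if x j = y ∧ u j = a then (1 : ℝ) else 0) / ∑ j, if x j = y then (1 : ℝ) else 0

end Agents

end MFC

end

/-! Both functions are compared with a third: `optQ`, the optimal state-action value of the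
deterministic mean-field control problem. Its value function is a supremum over open-loop controls.
The dynamics are deterministic, so feedback gains nothing, and the index set of the supremum does
not depend on the initial distribution. The optimal value therefore inherits the Lipschitz constant
`L_r / (1 - γ L_Φ)` of each `openLoopValue`, and shifting a control sequence gives the Bellman
equation without selecting maximizers (`optQ_le_optValue`, `optValue_le_of_optQ_le`).

Kernel side (`abs_optQ_sub_kernelReg_le`): at the net point with the largest error, the two Bellman
equations differ by the sampling error, the interpolation error, the restriction of the controls to
the net, and `γ` times that same largest error. Solving this inequality gives the two terms in `ε`.

Agent side (`abs_agentQ_sub_optQ_le`): with the empirical local policy, the mean-field reward and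
dynamics agree exactly with the average reward and the conditional mean of the next empirical
distribution. Hence one step costs only the fluctuation of averages of independent draws, which is
`O(1 / √N)` by `expect_l1dist_avgProb_le`. A discounted telescoping argument,
`tsum_pow_mul_le_of_potential`, sums these costs. For the upper bound, every realized action profile
is itself a mean-field control, so no policy can beat the mean-field optimum by more than the
fluctuations. For the lower bound, open-loop controls are policies constant in the state
distribution, which belong to every class of policies considered. -/

noncomputable section

namespace MFC

/-! ### Finite expectations and the `l¹` distance. -/

section Expectation

variable {S T : Type*} [Fintype S] [Fintype T]

/-- The expectation of `f` under the probability vector `p`. -/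
def expect (p : Prob S) (f : S → ℝ) : ℝ := ∑ s, p.1 s * f s

lemma prob_nonneg (p : Prob S) (s : S) : 0 ≤ p.1 s := p.2.1 s

lemma prob_sum (p : Prob S) : ∑ s, p.1 s = 1 := p.2.2

lemma prob_le_one (p : Prob S) (s : S) : p.1 s ≤ 1 := by
  rw [← prob_sum p]
  exact Finset.single_le_sum (fun i _ => prob_nonneg p i) (Finset.mem_univ s)

lemma expect_const (p : Prob S) (a : ℝ) : expect p (fun _ => a) = a := by
  simp [expect, ← Finset.sum_mul, prob_sum p]

lemma expect_mono (p : Prob S) {f g : S → ℝ} (h : ∀ s, f s ≤ g s) : expect p f ≤ expect p g :=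
  Finset.sum_le_sum fun s _ => mul_le_mul_of_nonneg_left (h s) (prob_nonneg p s)

lemma expect_add (p : Prob S) (f g : S → ℝ) :
    expect p (fun s => f s + g s) = expect p f + expect p g := by
  simp [expect, mul_add, Finset.sum_add_distrib]

lemma expect_sub (p : Prob S) (f g : S → ℝ) :
    expect p (fun s => f s - g s) = expect p f - expect p g := by
  simp [expect, mul_sub, Finset.sum_sub_distrib]

lemma expect_const_mul (p : Prob S) (a : ℝ) (f : S → ℝ) :
    expect p (fun s => a * f s) = a * expect p f := by
  simp only [expect, Finset.mul_sum]
  exact Finset.sum_congr rfl fun s _ => by ring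

lemma expect_div_const (p : Prob S) (a : ℝ) (f : S → ℝ) :
    expect p (fun s => f s / a) = expect p f / a := by
  simp only [expect, Finset.sum_div]
  exact Finset.sum_congr rfl fun s _ => by ring

lemma expect_sum {ι : Type*} (t : Finset ι) (p : Prob S) (f : ι → S → ℝ) :
    expect p (fun s => ∑ i ∈ t, f i s) = ∑ i ∈ t, expect p (f i) := by
  simp only [expect, Finset.mul_sum]
  exact Finset.sum_comm

lemma expect_le_of_le (p : Prob S) {f : S → ℝ} {a : ℝ} (h : ∀ s, f s ≤ a) : expect p f ≤ a :=
  (expect_mono p h).trans_eq (expect_const p a)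

lemma le_expect_of_le (p : Prob S) {f : S → ℝ} {a : ℝ} (h : ∀ s, a ≤ f s) : a ≤ expect p f :=
  (expect_const p a).symm.trans_le (expect_mono p h)

lemma abs_expect_le (p : Prob S) {f : S → ℝ} {a : ℝ} (h : ∀ s, |f s| ≤ a) :
    |expect p f| ≤ a :=
  abs_le.2 ⟨le_expect_of_le p fun s => (abs_le.1 (h s)).1,
    expect_le_of_le p fun s => (abs_le.1 (h s)).2⟩

lemma expect_mix (p : Prob S) (k : S → Prob T) (f : T → ℝ) :
    expect (mix p k) f = expect p fun s => expect (k s) f := by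
  simp only [expect, mix, Finset.sum_mul, Finset.mul_sum]
  rw [Finset.sum_comm]
  exact Finset.sum_congr rfl fun s _ => Finset.sum_congr rfl fun b _ => by ring

lemma mix_apply (p : Prob S) (k : S → Prob T) (b : T) :
    (mix p k).1 b = expect p fun s => (k s).1 b := rfl

lemma expect_sq_sub (p : Prob S) (f : S → ℝ) :
    expect p (fun s => (f s - expect p f) ^ 2) = expect p (fun s => f s ^ 2) - expect p f ^ 2 := by
  have e : (fun s => (f s - expect p f) ^ 2)
      = fun s => f s ^ 2 - 2 * expect p f * f s + expect p f ^ 2 := by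
    funext s; ring
  rw [e, expect_add, expect_sub, expect_const_mul, expect_const]
  ring

lemma sq_expect_le (p : Prob S) (f : S → ℝ) : expect p f ^ 2 ≤ expect p fun s => f s ^ 2 :=
  sub_nonneg.1 <| (le_expect_of_le p fun _ => sq_nonneg _).trans_eq (expect_sq_sub p f)

lemma expect_sq_sub_le (p : Prob S) (f : S → ℝ) :
    expect p (fun s => (f s - expect p f) ^ 2) ≤ expect p fun s => f s ^ 2 :=
  (expect_sq_sub p f).trans_le (sub_le_self _ (sq_nonneg _))

open Classical in
/-- The point mass at `s`. -/
def dirac (s : S) : Prob S := ⟨Pi.single s 1, single_mem_stdSimplex ℝ s⟩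

lemma expect_single [DecidableEq S] (s : S) (hs : Pi.single s 1 ∈ stdSimplex ℝ S) (f : S → ℝ) :
    expect ⟨Pi.single s 1, hs⟩ f = f s := by
  simp [expect, Pi.single_apply]

lemma l1dist_nonneg (p q : Prob S) : 0 ≤ l1dist p q :=
  Finset.sum_nonneg fun _ _ => abs_nonneg _

lemma l1dist_comm (p q : Prob S) : l1dist p q = l1dist q p :=
  Finset.sum_congr rfl fun _ _ => abs_sub_comm _ _

lemma l1dist_self (p : Prob S) : l1dist p p = 0 := by simp [l1dist]

lemma l1dist_triangle (p q r : Prob S) : l1dist p r ≤ l1dist p q + l1dist q r := by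
  simp only [l1dist, ← Finset.sum_add_distrib]
  exact Finset.sum_le_sum fun s _ => abs_sub_le _ _ _

/-- Expectations depend in a Lipschitz way on the law and on the integrand. -/
lemma abs_expect_sub_le {p q : Prob S} {f g : S → ℝ} {D R : ℝ} (hfg : ∀ s, |f s - g s| ≤ D)
    (hg : ∀ s, |g s| ≤ R) : |expect p f - expect q g| ≤ D + R * l1dist p q := by
  have e : expect p f - expect q g
      = expect p (fun s => f s - g s) + ∑ s, (p.1 s - q.1 s) * g s := by
    rw [expect_sub]
    simp only [expect, sub_mul, Finset.sum_sub_distrib]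
    ring
  rw [e]
  refine (abs_add_le _ _).trans (add_le_add (abs_expect_le p hfg) ?_)
  refine (Finset.abs_sum_le_sum_abs _ _).trans ?_
  rw [l1dist, Finset.mul_sum]
  refine Finset.sum_le_sum fun s _ => ?_
  rw [abs_mul, mul_comm]
  exact mul_le_mul_of_nonneg_right (hg s) (abs_nonneg _)

/-- Split `p k - q k'` as `p (k - k') + (p - q) k'`. Each `k' s` has total mass one, so the change
of the mixing law enters with constant exactly one. -/
lemma l1dist_mix_le {p q : Prob S} {k k' : S → Prob T} {D : ℝ}
    (h : ∀ s, l1dist (k s) (k' s) ≤ D) : l1dist (mix p k) (mix q k') ≤ D + l1dist p q := by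
  have h1 : l1dist (mix p k) (mix q k')
      ≤ ∑ b, ∑ s, (p.1 s * |(k s).1 b - (k' s).1 b| + |p.1 s - q.1 s| * (k' s).1 b) := by
    refine Finset.sum_le_sum fun b _ => ?_
    simp only [mix, ← Finset.sum_sub_distrib]
    refine (Finset.abs_sum_le_sum_abs _ _).trans (Finset.sum_le_sum fun s _ => ?_)
    have e : p.1 s * (k s).1 b - q.1 s * (k' s).1 b
        = p.1 s * ((k s).1 b - (k' s).1 b) + (p.1 s - q.1 s) * (k' s).1 b := by ring
    rw [e]
    refine (abs_add_le _ _).trans_eq ?_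
    rw [abs_mul, abs_mul, abs_of_nonneg (prob_nonneg p s), abs_of_nonneg (prob_nonneg (k' s) b)]
  refine h1.trans ?_
  rw [Finset.sum_comm]
  simp only [Finset.sum_add_distrib, ← Finset.mul_sum, prob_sum, mul_one]
  exact add_le_add (expect_le_of_le p h) le_rfl

end Expectation

/-! ### Independent draws and concentration of averages. -/

section Concentration

variable {S T : Type*} [Fintype S] [Fintype T] {N : ℕ}

lemma expect_indep_prod (p : Fin N → Prob S) (f : Fin N → S → ℝ) :
    expect (indep p) (fun y => ∏ j, f j (y j)) = ∏ j, expect (p j) (f j) := by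
  classical
  simp only [expect, indep, ← Finset.prod_mul_distrib]
  rw [Finset.prod_univ_sum, Fintype.piFinset_univ]

/-- Centered functions of different agents are orthogonal. The product of two factors is padded with
ones to a product over all agents, so that `expect_indep_prod` applies. -/
lemma expect_indep_mul (p : Fin N → Prob S) (g : Fin N → S → ℝ)
    (hg : ∀ j, expect (p j) (g j) = 0) (j k : Fin N) :
    expect (indep p) (fun y => g j (y j) * g k (y k))
      = if j = k then expect (p j) (fun s => g j s ^ 2) else 0 := by
  classical
  have e : (fun y : Fin N → S => g j (y j) * g k (y k))
      = fun y => ∏ i, ((if i = j then g i (y i) else 1) * (if i = k then g i (y i) else 1)) := by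
    funext y
    rw [Finset.prod_mul_distrib]
    simp
  rw [e, expect_indep_prod p fun i s => (if i = j then g i s else 1) * (if i = k then g i s else 1)]
  split_ifs with hjk
  · subst hjk
    rw [Finset.prod_eq_single j]
    · simp [sq]
    · intro i _ hi
      simp [hi, expect_const]
    · simp
  · refine Finset.prod_eq_zero (Finset.mem_univ j) ?_
    simp [hjk, hg]

lemma expect_indep_sq_sum (p : Fin N → Prob S) (g : Fin N → S → ℝ)
    (hg : ∀ j, expect (p j) (g j) = 0) :
    expect (indep p) (fun y => (∑ j, g j (y j)) ^ 2)
      = ∑ j, expect (p j) (fun s => g j s ^ 2) := by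
  simp only [sq (∑ j, g j _), Finset.sum_mul_sum]
  rw [expect_sum]
  simp only [expect_sum, expect_indep_mul p g hg]
  simp

lemma expect_indep_apply (p : Fin N → Prob S) (j : Fin N) (g : S → ℝ) :
    expect (indep p) (fun y => g (y j)) = expect (p j) g := by
  classical
  have e : (fun y : Fin N → S => g (y j)) = fun y => ∏ i, if i = j then g (y i) else 1 := by
    funext y
    simp
  rw [e, expect_indep_prod p fun i s => if i = j then g s else 1, Finset.prod_eq_single j]
  · simp
  · intro i _ hi
    simp [hi, expect_const]
  · simp

variable [NeZero N]

/-- The average of `N` probability vectors. -/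
def avgProb (q : Fin N → Prob T) : Prob T :=
  ⟨fun b => (∑ j, (q j).1 b) / N,
    fun b => div_nonneg (Finset.sum_nonneg fun j _ => prob_nonneg (q j) b) (Nat.cast_nonneg N), by
      rw [← Finset.sum_div, Finset.sum_comm]
      simp only [prob_sum]
      simp [NeZero.ne N]⟩

lemma sum_div_le_of_le {f : Fin N → ℝ} {a : ℝ} (h : ∀ j, f j ≤ a) : (∑ j, f j) / N ≤ a := by
  have hN : (0 : ℝ) < N := Nat.cast_pos.2 (NeZero.pos N)
  rw [div_le_iff₀ hN]
  calc ∑ j, f j ≤ ∑ _j : Fin N, a := Finset.sum_le_sum fun j _ => h j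
    _ = a * N := by simp [mul_comm]

lemma abs_sum_div_le_of_le {f : Fin N → ℝ} {a : ℝ} (h : ∀ j, |f j| ≤ a) :
    |(∑ j, f j) / N| ≤ a := by
  rw [abs_div, Nat.abs_cast]
  exact (div_le_div_of_nonneg_right (Finset.abs_sum_le_sum_abs _ _) (Nat.cast_nonneg N)).trans
    (sum_div_le_of_le h)

lemma l1dist_avgProb_le {q q' : Fin N → Prob T} {D : ℝ} (h : ∀ j, l1dist (q j) (q' j) ≤ D) :
    l1dist (avgProb q) (avgProb q') ≤ D := by
  refine le_trans ?_ (sum_div_le_of_le h)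
  simp only [l1dist]
  rw [Finset.sum_comm, Finset.sum_div]
  refine Finset.sum_le_sum fun b _ => ?_
  simp only [avgProb]
  rw [← sub_div, ← Finset.sum_sub_distrib, abs_div, Nat.abs_cast]
  exact div_le_div_of_nonneg_right (Finset.abs_sum_le_sum_abs _ _) (Nat.cast_nonneg N)

lemma expect_empirical (y : Fin N → S) (f : S → ℝ) :
    expect (empirical y) f = (∑ j, f (y j)) / N := by
  classical
  simp only [expect, empirical, div_mul_eq_mul_div, ← Finset.sum_div, Finset.sum_mul]
  rw [Finset.sum_comm]
  simp

lemma mix_empirical (y : Fin N → S) (k : S → Prob T) :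
    mix (empirical y) k = avgProb fun j => k (y j) :=
  Subtype.ext <| funext fun b => by rw [mix_apply, expect_empirical]; rfl

/-- Makes an empirical distribution an average of random point masses with mean the average law, a
case of the concentration bound below. -/
lemma mix_dirac (p : Prob S) : mix p dirac = p := by
  classical
  refine Subtype.ext <| funext fun b => ?_
  simp [mix, dirac, Pi.single_apply]

lemma empirical_eq_avgProb (y : Fin N → S) : empirical y = avgProb fun j => dirac (y j) := by
  rw [← mix_empirical, mix_dirac]

/-- The average of `N` independent random probability vectors concentrates around its mean. -/
lemma expect_l1dist_avgProb_le (p : Fin N → Prob S) (f : Fin N → S → Prob T) :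
    expect (indep p) (fun s => l1dist (avgProb fun j => f j (s j))
      (avgProb fun j => mix (p j) (f j))) ≤ √(Fintype.card T) / √N := by
  have hN : (0 : ℝ) < N := Nat.cast_pos.2 (NeZero.pos N)
  rw [← Real.sqrt_div (Nat.cast_nonneg _)]
  -- Jensen reduces the claim to a second moment; Cauchy–Schwarz over the coordinates then produces
  -- the factor `|T|`.
  refine Real.le_sqrt_of_sq_le ((sq_expect_le _ _).trans ?_)
  set g : T → Fin N → S → ℝ := fun b j s => (f j s).1 b - expect (p j) fun s => (f j s).1 b
  have h1 : ∀ s : Fin N → S, l1dist (avgProb fun j => f j (s j))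
      (avgProb fun j => mix (p j) (f j)) ^ 2
      ≤ Fintype.card T * ((∑ b, (∑ j, g b j (s j)) ^ 2) / (N : ℝ) ^ 2) := by
    intro s
    refine (sq_sum_le_card_mul_sum_sq).trans_eq ?_
    rw [Finset.card_univ, Finset.sum_div]
    congr 1
    refine Finset.sum_congr rfl fun b _ => ?_
    rw [sq_abs, ← div_pow]
    congr 1
    simp only [avgProb, g, mix_apply, Finset.sum_sub_distrib, sub_div]
  refine (expect_mono _ h1).trans ?_
  rw [expect_const_mul, expect_div_const, expect_sum, div_eq_mul_inv _ (N : ℝ)]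
  refine mul_le_mul_of_nonneg_left ?_ (Nat.cast_nonneg _)
  -- Entries lie in `[0, 1]`, so each variance is at most the mean. Summed over `b` the means give
  -- one per agent, so `N` in total, against the `N ^ 2` in the denominator.
  have h2 : ∀ b, expect (indep p) (fun y => (∑ j, g b j (y j)) ^ 2)
      ≤ ∑ j, expect (p j) (fun s => (f j s).1 b) := by
    intro b
    rw [expect_indep_sq_sum p (g b) fun j => by
      simp only [g]; rw [expect_sub, expect_const, sub_self]]
    refine Finset.sum_le_sum fun j _ => (expect_sq_sub_le _ _).trans (expect_mono _ fun s => ?_)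
    rw [sq]
    exact mul_le_of_le_one_left (prob_nonneg _ _) (prob_le_one _ _)
  rw [div_le_iff₀ (by positivity)]
  refine (Finset.sum_le_sum fun b _ => h2 b).trans_eq ?_
  rw [Finset.sum_comm]
  simp only [← expect_sum, prob_sum, expect_const]
  simp
  field_simp

end Concentration

/-! ### Lipschitz continuity of the aggregated reward and dynamics. -/

section Regularity

variable {X U : Type*} [Fintype U]

lemma distH_nonneg (h h' : LocalPolicy X U) : 0 ≤ distH h h' :=
  Real.iSup_nonneg fun _ => l1dist_nonneg _ _

lemma distH_self (h : LocalPolicy X U) : distH h h = 0 := by simp [distH, l1dist_self]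

variable [Fintype X]

lemma l1dist_le_distH (h h' : LocalPolicy X U) (x : X) : l1dist (h x) (h' x) ≤ distH h h' :=
  le_ciSup (f := fun x => l1dist (h x) (h' x)) (Set.finite_range _).bddAbove x

lemma distC_comm (c c' : Lifted X U) : distC c c' = distC c' c := by
  simp only [distC, distH, l1dist_comm]

lemma l1dist_actionDist_le (c c' : Lifted X U) :
    l1dist (actionDist c.1 c.2) (actionDist c'.1 c'.2) ≤ distC c c' :=
  (l1dist_mix_le (l1dist_le_distH c.2 c'.2)).trans_eq (add_comm _ _)

lemma aggReward_eq_expect (rt : X → Prob X → U → Prob U → ℝ) (c : Lifted X U) :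
    aggReward rt c = expect c.1 fun x => expect (c.2 x) fun u =>
      rt x c.1 u (actionDist c.1 c.2) := by
  simp only [aggReward, expect, Finset.mul_sum]
  exact Finset.sum_congr rfl fun x _ => Finset.sum_congr rfl fun u _ => by ring

variable {P : X → Prob X → U → Prob U → Prob X} {rt : X → Prob X → U → Prob U → ℝ}
  {LP R Lrt : ℝ}

lemma abs_aggReward_le (hr : RewardRegular rt R Lrt) (c : Lifted X U) : |aggReward rt c| ≤ R := by
  rw [aggReward_eq_expect]
  exact abs_expect_le _ fun x => abs_expect_le _ fun u => hr.1 _ _ _ _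

/-- The distributions `μ` and `ν(μ, h)` each move by at most `distC c c'`, whence `2 * Lrt`.
Changing the averaging laws costs `R` times the two parts of `distC`. The dynamics below are treated
in the same way. -/
lemma abs_aggReward_sub_le (hr : RewardRegular rt R Lrt) (hR : 0 ≤ R) (hL : 0 ≤ Lrt)
    (c c' : Lifted X U) : |aggReward rt c - aggReward rt c'| ≤ (R + 2 * Lrt) * distC c c' := by
  rw [aggReward_eq_expect, aggReward_eq_expect]
  have h1 : l1dist c.1 c'.1 ≤ distC c c' := le_add_of_nonneg_right (distH_nonneg _ _)
  have h2 := l1dist_actionDist_le c c'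
  refine (abs_expect_sub_le (D := Lrt * (distC c c' + distC c c') + R * distH c.2 c'.2) (R := R)
    (fun x => (abs_expect_sub_le (D := Lrt * (distC c c' + distC c c')) (R := R) (fun u => ?_)
      fun u => hr.1 _ _ _ _).trans ?_) fun x => abs_expect_le _ fun u => hr.1 _ _ _ _).trans_eq ?_
  · exact (hr.2 _ _ _ _ _ _).trans (mul_le_mul_of_nonneg_left (add_le_add h1 h2) hL)
  · gcongr
    exact l1dist_le_distH _ _ _
  · simp only [distC]; ring

lemma l1dist_aggDynamics_le (hP : TransitionRegular P LP) (hL : 0 ≤ LP) (c c' : Lifted X U) :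
    l1dist (aggDynamics P c) (aggDynamics P c') ≤ (2 * LP + 1) * distC c c' := by
  have h1 : l1dist c.1 c'.1 ≤ distC c c' := le_add_of_nonneg_right (distH_nonneg _ _)
  have h2 := l1dist_actionDist_le c c'
  refine (l1dist_mix_le (D := LP * (distC c c' + distC c c') + distH c.2 c'.2) fun x =>
    (l1dist_mix_le (D := LP * (distC c c' + distC c c')) fun u => ?_).trans ?_).trans_eq ?_
  · exact (hP _ _ _ _ _ _).trans (mul_le_mul_of_nonneg_left (add_le_add h1 h2) hL)
  · gcongr
    exact l1dist_le_distH _ _ _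
  · simp only [distC]; ring

end Regularity

/-! ### Discounted series with bounded terms. -/

lemma summable_pow_mul_of_bounded {γ M : ℝ} (hγ0 : 0 ≤ γ) (hγ1 : γ < 1) {a : ℕ → ℝ}
    (ha : ∀ t, |a t| ≤ M) : Summable fun t => γ ^ t * a t := by
  refine Summable.of_norm_bounded (g := fun t => γ ^ t * M)
    ((summable_geometric_of_lt_one hγ0 hγ1).mul_right M) fun t => ?_
  rw [Real.norm_eq_abs, abs_mul, abs_of_nonneg (pow_nonneg hγ0 t)]
  exact mul_le_mul_of_nonneg_left (ha t) (pow_nonneg hγ0 t)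

lemma abs_tsum_pow_mul_le {γ M : ℝ} (hγ0 : 0 ≤ γ) (hγ1 : γ < 1) {a : ℕ → ℝ}
    (ha : ∀ t, |a t| ≤ M) : |∑' t, γ ^ t * a t| ≤ M / (1 - γ) := by
  have hg := (hasSum_geometric_of_lt_one hγ0 hγ1).mul_right M
  rw [← div_eq_inv_mul] at hg
  rw [← Real.norm_eq_abs]
  refine tsum_of_norm_bounded hg fun t => ?_
  rw [Real.norm_eq_abs, abs_mul, abs_of_nonneg (pow_nonneg hγ0 t)]
  exact mul_le_mul_of_nonneg_left (ha t) (pow_nonneg hγ0 t)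

/-! ### The mean-field control problem and its Bellman equation. -/

section Value

variable {X U : Type*} [Fintype X] [Fintype U]

/-- The deterministic mean-field trajectory from `μ` under the open-loop controls `h`. -/
def trajectory (P : X → Prob X → U → Prob U → Prob X) (μ : Prob X) (h : ℕ → LocalPolicy X U) :
    ℕ → Prob X
  | 0 => μ
  | t + 1 => aggDynamics P (trajectory P μ h t, h t)

/-- The discounted reward along the trajectory from `μ` under the open-loop controls `h`. -/
def openLoopValue (P : X → Prob X → U → Prob U → Prob X) (rt : X → Prob X → U → Prob U → ℝ)
    (γ : ℝ) (μ : Prob X) (h : ℕ → LocalPolicy X U) : ℝ :=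
  ∑' t, γ ^ t * aggReward rt (trajectory P μ h t, h t)

/-- The optimal value of the mean-field control problem. -/
def optValue (P : X → Prob X → U → Prob U → Prob X) (rt : X → Prob X → U → Prob U → ℝ)
    (γ : ℝ) (μ : Prob X) : ℝ :=
  ⨆ h : ℕ → LocalPolicy X U, openLoopValue P rt γ μ h

/-- The optimal state-action value of the mean-field control problem. -/
def optQ (P : X → Prob X → U → Prob U → Prob X) (rt : X → Prob X → U → Prob U → ℝ)
    (γ : ℝ) (c : Lifted X U) : ℝ :=
  aggReward rt c + γ * optValue P rt γ (aggDynamics P c)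

variable {P : X → Prob X → U → Prob U → Prob X} {rt : X → Prob X → U → Prob U → ℝ}
  {LP R Lrt γ : ℝ}

lemma trajectory_succ (μ : Prob X) (h : ℕ → LocalPolicy X U) (t : ℕ) :
    trajectory P μ h (t + 1)
      = trajectory P (aggDynamics P (μ, h 0)) (fun n => h (n + 1)) t := by
  induction t with
  | zero => rfl
  | succ t ih =>
    rw [trajectory, ih]
    rfl

lemma openLoopValue_eq (hr : RewardRegular rt R Lrt) (hγ0 : 0 ≤ γ) (hγ1 : γ < 1) (μ : Prob X)
    (h : ℕ → LocalPolicy X U) :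
    openLoopValue P rt γ μ h = aggReward rt (μ, h 0)
      + γ * openLoopValue P rt γ (aggDynamics P (μ, h 0)) fun n => h (n + 1) := by
  rw [openLoopValue, (summable_pow_mul_of_bounded hγ0 hγ1
    fun t => abs_aggReward_le hr (trajectory P μ h t, h t)).tsum_eq_zero_add]
  rw [pow_zero, one_mul, openLoopValue, ← tsum_mul_left]
  congr 1
  refine tsum_congr fun t => ?_
  rw [trajectory_succ, pow_succ]
  ring

lemma abs_openLoopValue_le (hr : RewardRegular rt R Lrt) (hγ0 : 0 ≤ γ) (hγ1 : γ < 1) (μ : Prob X)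
    (h : ℕ → LocalPolicy X U) : |openLoopValue P rt γ μ h| ≤ R / (1 - γ) :=
  abs_tsum_pow_mul_le hγ0 hγ1 fun _ => abs_aggReward_le hr _

lemma l1dist_trajectory_le (hP : TransitionRegular P LP) (hLP : 0 ≤ LP) (μ μ' : Prob X)
    (h : ℕ → LocalPolicy X U) (t : ℕ) :
    l1dist (trajectory P μ h t) (trajectory P μ' h t) ≤ (2 * LP + 1) ^ t * l1dist μ μ' := by
  induction t with
  | zero => simp [trajectory]
  | succ t ih =>
    refine (l1dist_aggDynamics_le hP hLP _ _).trans ?_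
    simp only [distC, distH_self, add_zero]
    rw [pow_succ', mul_assoc]
    gcongr

/-- Under common controls, trajectories separate by a factor at most `2 * LP + 1` per step, so the
reward differences are dominated by a geometric series of ratio `γ * (2 * LP + 1)`. -/
lemma abs_openLoopValue_sub_le (hP : TransitionRegular P LP) (hr : RewardRegular rt R Lrt)
    (hLP : 0 ≤ LP) (hR : 0 ≤ R) (hL : 0 ≤ Lrt) (hγ0 : 0 ≤ γ) (hγ1 : γ < 1)
    (hγ : γ * (2 * LP + 1) < 1) (μ μ' : Prob X) (h : ℕ → LocalPolicy X U) :
    |openLoopValue P rt γ μ h - openLoopValue P rt γ μ' h|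
      ≤ (R + 2 * Lrt) / (1 - γ * (2 * LP + 1)) * l1dist μ μ' := by
  rw [openLoopValue, openLoopValue, ← (summable_pow_mul_of_bounded hγ0 hγ1
    fun t => abs_aggReward_le hr (trajectory P μ h t, h t)).tsum_sub
    (summable_pow_mul_of_bounded hγ0 hγ1
      fun t => abs_aggReward_le hr (trajectory P μ' h t, h t))]
  have hg := (hasSum_geometric_of_lt_one (mul_nonneg hγ0 (by positivity)) hγ).mul_right
    ((R + 2 * Lrt) * l1dist μ μ')
  have e : (1 - γ * (2 * LP + 1))⁻¹ * ((R + 2 * Lrt) * l1dist μ μ')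
      = (R + 2 * Lrt) / (1 - γ * (2 * LP + 1)) * l1dist μ μ' := by ring
  rw [e] at hg
  rw [← Real.norm_eq_abs]
  refine tsum_of_norm_bounded hg fun t => ?_
  rw [← mul_sub, Real.norm_eq_abs, abs_mul, abs_of_nonneg (pow_nonneg hγ0 t)]
  calc γ ^ t * |aggReward rt (trajectory P μ h t, h t) - aggReward rt (trajectory P μ' h t, h t)|
      ≤ γ ^ t * ((R + 2 * Lrt) * ((2 * LP + 1) ^ t * l1dist μ μ')) := by
        refine mul_le_mul_of_nonneg_left ?_ (pow_nonneg hγ0 t)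
        refine (abs_aggReward_sub_le hr hR hL _ _).trans ?_
        simp only [distC, distH_self, add_zero]
        exact mul_le_mul_of_nonneg_left (l1dist_trajectory_le hP hLP _ _ _ _) (by positivity)
    _ = (γ * (2 * LP + 1)) ^ t * ((R + 2 * Lrt) * l1dist μ μ') := by rw [mul_pow]; ring

lemma openLoopValue_le_optValue (hr : RewardRegular rt R Lrt) (hγ0 : 0 ≤ γ) (hγ1 : γ < 1)
    (μ : Prob X) (h : ℕ → LocalPolicy X U) : openLoopValue P rt γ μ h ≤ optValue P rt γ μ :=
  le_ciSup (f := fun h => openLoopValue P rt γ μ h) ⟨R / (1 - γ), by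
    rintro _ ⟨h, rfl⟩
    exact (abs_le.1 (abs_openLoopValue_le hr hγ0 hγ1 μ h)).2⟩ h

variable [Nonempty U]

instance instNonemptyProb : Nonempty (Prob U) := ⟨dirac (Classical.arbitrary U)⟩

lemma abs_optValue_le (hr : RewardRegular rt R Lrt) (hγ0 : 0 ≤ γ) (hγ1 : γ < 1) (μ : Prob X) :
    |optValue P rt γ μ| ≤ R / (1 - γ) :=
  abs_le.2 ⟨(abs_le.1 (abs_openLoopValue_le hr hγ0 hγ1 μ
      (Classical.arbitrary (ℕ → LocalPolicy X U)))).1.trans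
      (openLoopValue_le_optValue hr hγ0 hγ1 μ _),
    ciSup_le fun h => (abs_le.1 (abs_openLoopValue_le hr hγ0 hγ1 μ h)).2⟩

lemma abs_optValue_sub_le (hP : TransitionRegular P LP) (hr : RewardRegular rt R Lrt)
    (hLP : 0 ≤ LP) (hR : 0 ≤ R) (hL : 0 ≤ Lrt) (hγ0 : 0 ≤ γ) (hγ1 : γ < 1)
    (hγ : γ * (2 * LP + 1) < 1) (μ μ' : Prob X) :
    |optValue P rt γ μ - optValue P rt γ μ'|
      ≤ (R + 2 * Lrt) / (1 - γ * (2 * LP + 1)) * l1dist μ μ' := by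
  have key : ∀ μ μ' : Prob X, optValue P rt γ μ
      ≤ optValue P rt γ μ' + (R + 2 * Lrt) / (1 - γ * (2 * LP + 1)) * l1dist μ μ' := by
    intro μ μ'
    refine ciSup_le fun h => ?_
    have h1 := (abs_le.1 (abs_openLoopValue_sub_le hP hr hLP hR hL hγ0 hγ1 hγ μ μ' h)).2
    have h2 := openLoopValue_le_optValue (P := P) hr hγ0 hγ1 μ' h
    linarith
  have h1 := key μ μ'
  have h2 := key μ' μ
  rw [l1dist_comm] at h2
  exact abs_le.2 ⟨by linarith, by linarith⟩

/-- Prepending `h` to any control sequence for the next state gives a competitor from `μ`. The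
inequality is solved for the value at the next state so that its supremum can be bounded termwise.
-/
lemma optQ_le_optValue (hr : RewardRegular rt R Lrt) (hγ0 : 0 < γ) (hγ1 : γ < 1) (μ : Prob X)
    (h : LocalPolicy X U) : optQ P rt γ (μ, h) ≤ optValue P rt γ μ := by
  suffices hs : optValue P rt γ (aggDynamics P (μ, h))
      ≤ (optValue P rt γ μ - aggReward rt (μ, h)) / γ by
    rw [le_div_iff₀ hγ0] at hs
    rw [optQ]
    linarith
  refine ciSup_le fun h' => ?_
  rw [le_div_iff₀ hγ0]
  have h1 := openLoopValue_le_optValue (P := P) hr hγ0.le hγ1 μ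
    fun n => Nat.casesOn n h h'
  rw [openLoopValue_eq hr hγ0.le hγ1] at h1
  have h2 : openLoopValue P rt γ (aggDynamics P (μ, h)) h' * γ
    = γ * openLoopValue P rt γ (aggDynamics P (μ, h)) h' := mul_comm _ _
  rw [h2]
  exact le_sub_iff_add_le'.2 h1

lemma optValue_le_of_optQ_le (hr : RewardRegular rt R Lrt) (hγ0 : 0 ≤ γ) (hγ1 : γ < 1)
    {μ : Prob X} {a : ℝ} (ha : ∀ h : LocalPolicy X U, optQ P rt γ (μ, h) ≤ a) :
    optValue P rt γ μ ≤ a := by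
  refine ciSup_le fun h => le_trans ?_ (ha (h 0))
  rw [openLoopValue_eq hr hγ0 hγ1, optQ]
  exact add_le_add le_rfl (mul_le_mul_of_nonneg_left
    (openLoopValue_le_optValue hr hγ0 hγ1 _ _) hγ0)

/-- The constant `L = L_r / (1 - γ L_Φ)` reproduces itself: `L_r + γ L L_Φ = L`. -/
lemma abs_optQ_sub_le (hP : TransitionRegular P LP) (hr : RewardRegular rt R Lrt)
    (hLP : 0 ≤ LP) (hR : 0 ≤ R) (hL : 0 ≤ Lrt) (hγ0 : 0 ≤ γ) (hγ1 : γ < 1)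
    (hγ : γ * (2 * LP + 1) < 1) (c c' : Lifted X U) :
    |optQ P rt γ c - optQ P rt γ c'|
      ≤ (R + 2 * Lrt) / (1 - γ * (2 * LP + 1)) * distC c c' := by
  have e : optQ P rt γ c - optQ P rt γ c' = (aggReward rt c - aggReward rt c')
      + γ * (optValue P rt γ (aggDynamics P c) - optValue P rt γ (aggDynamics P c')) := by
    rw [optQ, optQ]; ring
  have hpos : 0 < 1 - γ * (2 * LP + 1) := by linarith
  rw [e]
  refine (abs_add_le _ _).trans ?_
  rw [abs_mul, abs_of_nonneg hγ0]
  calc _ ≤ (R + 2 * Lrt) * distC c c' + γ * ((R + 2 * Lrt) / (1 - γ * (2 * LP + 1)) *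
        ((2 * LP + 1) * distC c c')) := by
        refine add_le_add (abs_aggReward_sub_le hr hR hL _ _)
          (mul_le_mul_of_nonneg_left ?_ hγ0)
        refine (abs_optValue_sub_le hP hr hLP hR hL hγ0 hγ1 hγ _ _).trans ?_
        gcongr
        exact l1dist_aggDynamics_le hP hLP _ _
    _ = _ := by field_simp; ring

end Value

/-! ### Error analysis of kernel Q-learning. -/

section Kernel

variable {X U : Type*} [Fintype X] [Fintype U] {P : X → Prob X → U → Prob U → Prob X}
  {rt : X → Prob X → U → Prob U → ℝ} {LP R Lrt γ ε LK : ℝ} {NK : ℕ}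
  {net : Finset (Lifted X U)} {K : net → Lifted X U → ℝ} {rhat : net → ℝ} {Φhat : net → Prob X}

/-- `Γ_K` is nonexpansive in the sup norm. -/
lemma abs_kernelReg_sub_le (hK : IsRegressionKernel ε net K NK LK) {f g : net → ℝ} {D : ℝ}
    (h : ∀ i, |f i - g i| ≤ D) (c : Lifted X U) :
    |kernelReg K f c - kernelReg K g c| ≤ D :=
  calc |kernelReg K f c - kernelReg K g c| = |∑ i, K i c * (f i - g i)| := by
        simp only [kernelReg, mul_sub, Finset.sum_sub_distrib]
    _ ≤ ∑ i, K i c * D := by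
        refine (Finset.abs_sum_le_sum_abs _ _).trans (Finset.sum_le_sum fun i _ => ?_)
        rw [abs_mul, abs_of_nonneg (hK.nonneg i c)]
        exact mul_le_mul_of_nonneg_left (h i) (hK.nonneg i c)
    _ = D := by rw [← Finset.sum_mul, hK.sum_eq_one, one_mul]

lemma abs_kernelReg_le (hK : IsRegressionKernel ε net K NK LK) {f : net → ℝ} {D : ℝ}
    (h : ∀ i, |f i| ≤ D) (c : Lifted X U) : |kernelReg K f c| ≤ D := by
  simpa [kernelReg] using abs_kernelReg_sub_le hK (f := f) (g := 0) (by simpa using h) c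

/-- The interpolation error of an `L`-Lipschitz function is at most `L * ε`. -/
lemma abs_sub_kernelReg_le (hK : IsRegressionKernel ε net K NK LK) {F : Lifted X U → ℝ} {L : ℝ}
    (hL : 0 ≤ L) (hF : ∀ c c', |F c - F c'| ≤ L * distC c c') (c : Lifted X U) :
    |F c - kernelReg K (fun i => F i.1) c| ≤ L * ε :=
  calc |F c - kernelReg K (fun i => F i.1) c| = |∑ i, K i c * (F c - F i.1)| := by
        simp only [kernelReg, mul_sub, Finset.sum_sub_distrib, ← Finset.sum_mul, hK.sum_eq_one,
          one_mul]
    _ ≤ ∑ i, K i c * (L * ε) := by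
        refine (Finset.abs_sum_le_sum_abs _ _).trans (Finset.sum_le_sum fun i _ => ?_)
        rw [abs_mul, abs_of_nonneg (hK.nonneg i c)]
        rcases lt_or_ge ε (distC i.1 c) with h | h
        · simp [hK.local_support i c h]
        · refine mul_le_mul_of_nonneg_left ((hF _ _).trans ?_) (hK.nonneg i c)
          rw [distC_comm]
          exact mul_le_mul_of_nonneg_left h hL
    _ = L * ε := by rw [← Finset.sum_mul, hK.sum_eq_one, one_mul]

/-- Only indices with positive weight at `c` or at `c'` contribute, and there are at most `2 * NK`
of them. -/
lemma abs_kernelReg_sub_le_distC (hK : IsRegressionKernel ε net K NK LK) {f : net → ℝ} {M : ℝ}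
    (hLK : 0 ≤ LK) (hf : ∀ i, |f i| ≤ M) (c c' : Lifted X U) :
    |kernelReg K f c - kernelReg K f c'| ≤ 2 * NK * LK * M * distC c c' := by
  classical
  have hd : 0 ≤ distC c c' := add_nonneg (l1dist_nonneg _ _) (distH_nonneg _ _)
  set s : Finset net := Finset.univ.filter fun i => 0 < K i c
  set s' : Finset net := Finset.univ.filter fun i => 0 < K i c'
  have hcard : ∀ c, (Finset.univ.filter fun i => 0 < K i c).card ≤ NK := fun c => by
    have := hK.card_pos_le c
    rwa [Set.ncard_eq_toFinset_card', Set.toFinset_ofPred] at this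
  have hs : ((s ∪ s').card : ℝ) ≤ 2 * NK := by
    have h1 := Finset.card_union_le s s'
    have h2 : s.card ≤ NK := hcard c
    have h3 : s'.card ≤ NK := hcard c'
    have : (s ∪ s').card ≤ 2 * NK := by omega
    exact_mod_cast this
  have hz : ∀ c i, ¬ 0 < K i c → K i c = 0 := fun c i h => le_antisymm (not_lt.1 h) (hK.nonneg i c)
  have e : kernelReg K f c - kernelReg K f c' = ∑ i ∈ s ∪ s', (K i c - K i c') * f i := by
    simp only [kernelReg, ← Finset.sum_sub_distrib, ← sub_mul]
    refine (Finset.sum_subset (Finset.subset_univ _) fun i _ hi => ?_).symm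
    simp only [s, s', Finset.mem_union, Finset.mem_filter, Finset.mem_univ, true_and, not_or] at hi
    simp [hz c i hi.1, hz c' i hi.2]
  rw [e]
  calc |∑ i ∈ s ∪ s', (K i c - K i c') * f i| ≤ ∑ i ∈ s ∪ s', LK * distC c c' * M := by
        refine (Finset.abs_sum_le_sum_abs _ _).trans (Finset.sum_le_sum fun i _ => ?_)
        rw [abs_mul]
        exact mul_le_mul (hK.lipschitz i c c') (hf i) (abs_nonneg _) (by positivity)
    _ = (s ∪ s').card * (LK * distC c c' * M) := by rw [Finset.sum_const, nsmul_eq_mul]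
    _ ≤ 2 * NK * (LK * distC c c' * M) := by
        -- That `M` is nonnegative must be read off from some index; one exists because the weights
        -- sum to one.
        rcases (s ∪ s').eq_empty_or_nonempty with h | ⟨i, _⟩
        · rw [h]
          rcases isEmpty_or_nonempty net with hn | ⟨⟨i⟩⟩
          · have := hK.sum_eq_one c
            simp at this
          · have : 0 ≤ M := (abs_nonneg _).trans (hf i)
            simp only [Finset.card_empty, Nat.cast_zero, zero_mul]
            positivity
        · have : 0 ≤ M := (abs_nonneg _).trans (hf i)
          gcongr
    _ = _ := by ring

lemma abs_ciSup_sub_ciSup_le {ι : Type*} [Finite ι] [Nonempty ι] {f g : ι → ℝ} {D : ℝ}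
    (h : ∀ i, |f i - g i| ≤ D) : |(⨆ i, f i) - ⨆ i, g i| ≤ D := by
  have hf := (Set.finite_range f).bddAbove
  have hg := (Set.finite_range g).bddAbove
  rw [abs_le]
  constructor
  · have : ⨆ i, g i ≤ (⨆ i, f i) + D := ciSup_le fun i => by
      have h1 := (abs_le.1 (h i)).1
      have h2 := le_ciSup hf i
      linarith
    linarith
  · have : ⨆ i, f i ≤ (⨆ i, g i) + D := ciSup_le fun i => by
      have h1 := (abs_le.1 (h i)).2
      have h2 := le_ciSup hg i
      linarith
    linarith

instance instFiniteNetH : Finite (netH net) :=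
  (net.finite_toSet.image Prod.snd).to_subtype

lemma nonempty_netH (i : net) : Nonempty (netH net) := ⟨⟨i.1.2, i.1, i.2, rfl⟩⟩

lemma abs_bellmanHat_sub_le (hK : IsRegressionKernel ε net K NK LK) (hγ0 : 0 ≤ γ)
    {q q' : net → ℝ} {D : ℝ} (h : ∀ i, |q i - q' i| ≤ D) (i : net) :
    |bellmanHat γ K rhat Φhat q i - bellmanHat γ K rhat Φhat q' i| ≤ γ * D := by
  have := nonempty_netH i
  rw [bellmanHat, bellmanHat, add_sub_add_left_eq_sub, ← mul_sub, abs_mul, abs_of_nonneg hγ0]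
  exact mul_le_mul_of_nonneg_left
    (abs_ciSup_sub_ciSup_le fun h' => abs_kernelReg_sub_le hK h _) hγ0

lemma contracting_bellmanHat (hK : IsRegressionKernel ε net K NK LK) (hγ0 : 0 ≤ γ)
    (hγ1 : γ < 1) : ContractingWith ⟨γ, hγ0⟩ (bellmanHat γ K rhat Φhat) := by
  refine ⟨hγ1, LipschitzWith.of_dist_le_mul fun q q' => ?_⟩
  rw [dist_pi_le_iff (by positivity)]
  intro i
  exact abs_bellmanHat_sub_le hK hγ0 (fun j => dist_le_pi_dist q q' j) i

/-- At a point where `|q|` is largest, the fixed point equation gives `|q m| ≤ R + γ * |q m|`. -/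
lemma abs_le_of_bellmanHat_eq (hK : IsRegressionKernel ε net K NK LK) (hγ0 : 0 ≤ γ) (hγ1 : γ < 1)
    (hrhat : ∀ i, |rhat i| ≤ R) {q : net → ℝ} (hq : bellmanHat γ K rhat Φhat q = q) (i : net) :
    |q i| ≤ R / (1 - γ) := by
  obtain ⟨m, -, hm⟩ := Finset.exists_max_image Finset.univ (fun i => |q i|) ⟨i, Finset.mem_univ i⟩
  have hne := nonempty_netH i
  have h1 : |q m| ≤ R + γ * |q m| := by
    conv_lhs => rw [← hq]
    refine (abs_add_le _ _).trans (add_le_add (hrhat m) ?_)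
    rw [abs_mul, abs_of_nonneg hγ0]
    refine mul_le_mul_of_nonneg_left ?_ hγ0
    have := abs_ciSup_sub_ciSup_le (f := fun h : netH net => kernelReg K q (Φhat m, h.1))
      (g := fun _ => 0) (D := |q m|) fun h => by
        rw [sub_zero]
        exact abs_kernelReg_le hK (fun j => hm j (Finset.mem_univ j)) _
    simpa using this
  refine (hm i (Finset.mem_univ i)).trans ?_
  rw [le_div_iff₀ (by linarith)]
  linarith

lemma sum_div_succ_le {n : ℕ} {f : Fin (n + 1) → ℝ} {a : ℝ} (h : ∀ j, f j ≤ a) :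
    (∑ j, f j) / (n + 1) ≤ a := by
  exact_mod_cast sum_div_le_of_le h

lemma abs_sum_div_succ_le {n : ℕ} {f : Fin (n + 1) → ℝ} {a : ℝ} (h : ∀ j, |f j| ≤ a) :
    |(∑ j, f j) / (n + 1)| ≤ a := by
  exact_mod_cast abs_sum_div_le_of_le h

lemma IsSampledFrom.abs_le {c : Lifted X U} {r : ℝ} {φ : Prob X}
    (hs : IsSampledFrom P rt ε c r φ) (hr : RewardRegular rt R Lrt) : |r| ≤ R := by
  obtain ⟨n, s, -, rfl, -⟩ := hs
  exact abs_sum_div_succ_le fun k => abs_aggReward_le hr _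

lemma IsSampledFrom.abs_sub_le {c : Lifted X U} {r : ℝ} {φ : Prob X}
    (hs : IsSampledFrom P rt ε c r φ) (hr : RewardRegular rt R Lrt) (hR : 0 ≤ R) (hL : 0 ≤ Lrt) :
    |aggReward rt c - r| ≤ (R + 2 * Lrt) * ε := by
  obtain ⟨n, s, hd, rfl, -⟩ := hs
  have hn : (n + 1 : ℝ) ≠ 0 := by positivity
  have e : aggReward rt c - (∑ k, aggReward rt (s k)) / (n + 1)
      = (∑ k, (aggReward rt c - aggReward rt (s k))) / (n + 1) := by
    rw [Finset.sum_sub_distrib, sub_div]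
    simp
    field_simp
  rw [e]
  exact abs_sum_div_succ_le fun k => (abs_aggReward_sub_le hr hR hL _ _).trans
    (mul_le_mul_of_nonneg_left (hd k).le (by positivity))

lemma IsSampledFrom.l1dist_le {c : Lifted X U} {r : ℝ} {φ : Prob X}
    (hs : IsSampledFrom P rt ε c r φ) (hP : TransitionRegular P LP) (hLP : 0 ≤ LP) :
    l1dist (aggDynamics P c) φ ≤ (2 * LP + 1) * ε := by
  obtain ⟨n, s, hd, -, hφ⟩ := hs
  have e1 : φ = avgProb fun k => aggDynamics P (s k) :=
    Subtype.ext <| funext fun y => by rw [hφ]; simp [avgProb]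
  have e2 : aggDynamics P c = avgProb fun _ : Fin (n + 1) => aggDynamics P c :=
    Subtype.ext <| funext fun y => by
      have hn : (n + 1 : ℝ) ≠ 0 := by positivity
      simp [avgProb]
      field_simp
  rw [e1, e2]
  exact l1dist_avgProb_le fun k => (l1dist_aggDynamics_le hP hLP _ _).trans
    (mul_le_mul_of_nonneg_left (hd k).le (by positivity))

variable [Nonempty U]

/-- The maximum over the net approximates the optimal value. -/
lemma abs_optValue_sub_ciSup_le (hP : TransitionRegular P LP) (hr : RewardRegular rt R Lrt)
    (hLP : 0 ≤ LP) (hR : 0 ≤ R) (hL : 0 ≤ Lrt) (hγ0 : 0 < γ) (hγ1 : γ < 1)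
    (hγ : γ * (2 * LP + 1) < 1) (hnet : IsNet ε net) (μ : Prob X) :
    |optValue P rt γ μ - ⨆ h : netH net, optQ P rt γ (μ, h.1)|
      ≤ (R + 2 * Lrt) / (1 - γ * (2 * LP + 1)) * ε := by
  have hLQ : 0 ≤ (R + 2 * Lrt) / (1 - γ * (2 * LP + 1)) := div_nonneg (by positivity) (by linarith)
  obtain ⟨c₀, hc₀, h₀⟩ := hnet (μ, Classical.arbitrary _)
  have hε : 0 ≤ ε := (add_nonneg (l1dist_nonneg _ _) (distH_nonneg _ _)).trans h₀.le
  have := nonempty_netH ⟨c₀, hc₀⟩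
  have hbdd : BddAbove (Set.range fun h : netH net => optQ P rt γ (μ, h.1)) :=
    (Set.finite_range _).bddAbove
  rw [abs_le]
  constructor
  · have : ⨆ h : netH net, optQ P rt γ (μ, h.1) ≤ optValue P rt γ μ :=
      ciSup_le fun h => optQ_le_optValue hr hγ0 hγ1 _ _
    have := mul_nonneg hLQ hε
    linarith
  · have : optValue P rt γ μ ≤ (⨆ h : netH net, optQ P rt γ (μ, h.1))
        + (R + 2 * Lrt) / (1 - γ * (2 * LP + 1)) * ε := by
      refine optValue_le_of_optQ_le hr hγ0.le hγ1 fun h => ?_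
      -- Only the local policy of the nearby net point is kept; restoring the first component to `μ`
      -- can only reduce the distance.
      obtain ⟨c, hc, hd⟩ := hnet (μ, h)
      have h1 := (abs_le.1 (abs_optQ_sub_le hP hr hLP hR hL hγ0.le hγ1 hγ (μ, h) (μ, c.2))).2
      have h2 : optQ P rt γ (μ, c.2) ≤ ⨆ h : netH net, optQ P rt γ (μ, h.1) :=
        le_ciSup hbdd ⟨c.2, c, hc, rfl⟩
      have h3 : distC (μ, h) (μ, c.2) ≤ ε := by
        refine le_trans ?_ hd.le
        simp only [distC, l1dist_self]
        gcongr
        exact l1dist_nonneg _ _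
      have h4 := mul_le_mul_of_nonneg_left h3 hLQ
      linarith
    linarith

/-- The kernel-based algorithm approximates the optimal state-action value. -/
theorem abs_optQ_sub_kernelReg_le (hP : TransitionRegular P LP) (hr : RewardRegular rt R Lrt)
    (hLP : 0 ≤ LP) (hR : 0 ≤ R) (hL : 0 ≤ Lrt) (hγ0 : 0 < γ) (hγ1 : γ < 1)
    (hγ : γ * (2 * LP + 1) < 1) (hnet : IsNet ε net) (hK : IsRegressionKernel ε net K NK LK)
    (hLK : 0 ≤ LK) (hs : ∀ i, IsSampledFrom P rt ε i.1 (rhat i) (Φhat i)) {q : net → ℝ}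
    (hq : bellmanHat γ K rhat Φhat q = q) (c : Lifted X U) :
    |optQ P rt γ c - kernelReg K q c| ≤
      ((R + 2 * Lrt) + 2 * γ * NK * LK * (R / (1 - γ)) * (2 * LP + 1)) / (1 - γ) * ε
        + 2 * (R + 2 * Lrt) / ((1 - γ * (2 * LP + 1)) * (1 - γ)) * ε := by
  have hγ' : 0 < 1 - γ := by linarith
  have hpos : 0 < 1 - γ * (2 * LP + 1) := by linarith
  set LQ := (R + 2 * Lrt) / (1 - γ * (2 * LP + 1)) with hLQdef
  have hLQ : 0 ≤ LQ := div_nonneg (by positivity) hpos.le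
  obtain ⟨c₀, hc₀, h₀⟩ := hnet c
  have hε : 0 ≤ ε := (add_nonneg (l1dist_nonneg _ _) (distH_nonneg _ _)).trans h₀.le
  obtain ⟨m, -, hm⟩ := Finset.exists_max_image Finset.univ
    (fun i : net => |optQ P rt γ i.1 - q i|) ⟨⟨c₀, hc₀⟩, Finset.mem_univ _⟩
  have hne := nonempty_netH m
  have hqb := abs_le_of_bellmanHat_eq hK hγ0.le hγ1 (fun i => (hs i).abs_le hr) hq
  set δ := |optQ P rt γ m.1 - q m| 
  -- The largest error `δ` on the net controls the error everywhere, up to interpolation of `optQ`.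
  have hglob : ∀ c, |optQ P rt γ c - kernelReg K q c| ≤ LQ * ε + δ := fun c =>
    (abs_sub_le _ (kernelReg K (fun i => optQ P rt γ i.1) c) _).trans (add_le_add
      (abs_sub_kernelReg_le hK hLQ
        (abs_optQ_sub_le hP hr hLP hR hL hγ0.le hγ1 hγ) c)
      (abs_kernelReg_sub_le hK (fun i => hm i (Finset.mem_univ i)) c))
  -- The three costs are: restricting the controls to the net, replacing `optQ` by the regression of
  -- `q`, and moving from the true next state to the estimated one.
  have hmax : |optValue P rt γ (aggDynamics P m.1) - ⨆ h : netH net, kernelReg K q (Φhat m, h.1)|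
      ≤ LQ * ε + (LQ * ε + δ)
        + 2 * NK * LK * (R / (1 - γ)) * ((2 * LP + 1) * ε) := by
    refine (abs_sub_le _ (⨆ h : netH net, kernelReg K q (aggDynamics P m.1, h.1)) _).trans
      (add_le_add ?_ ?_)
    · refine (abs_sub_le _ (⨆ h : netH net, optQ P rt γ (aggDynamics P m.1, h.1)) _).trans
        (add_le_add (abs_optValue_sub_ciSup_le hP hr hLP hR hL hγ0 hγ1 hγ hnet _)
          (abs_ciSup_sub_ciSup_le fun h => hglob _))
    · refine abs_ciSup_sub_ciSup_le fun h => (abs_kernelReg_sub_le_distC hK hLK hqb _ _).trans ?_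
      refine mul_le_mul_of_nonneg_left ?_ (by positivity)
      simp only [distC, distH_self, add_zero]
      exact (hs m).l1dist_le hP hLP
  have hδ' : δ ≤ (R + 2 * Lrt) * ε + γ * (LQ * ε + (LQ * ε + δ)
      + 2 * NK * LK * (R / (1 - γ)) * ((2 * LP + 1) * ε)) := by
    have e : optQ P rt γ m.1 - q m = (aggReward rt m.1 - rhat m)
        + γ * (optValue P rt γ (aggDynamics P m.1)
          - ⨆ h : netH net, kernelReg K q (Φhat m, h.1)) := by
      conv_lhs => rw [← hq]
      rw [optQ, bellmanHat]
      ring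
    refine (congrArg abs e).trans_le ((abs_add_le _ _).trans
      (add_le_add ((hs m).abs_sub_le hr hR hL) ?_))
    rw [abs_mul, abs_of_pos hγ0]
    exact mul_le_mul_of_nonneg_left hmax hγ0.le
  refine (hglob c).trans ?_
  have e2 : 2 * (R + 2 * Lrt) / ((1 - γ * (2 * LP + 1)) * (1 - γ)) * ε
      = 2 * (LQ * ε) / (1 - γ) := by
    rw [hLQdef]; field_simp
  rw [e2, div_mul_eq_mul_div _ (1 - γ) ε, ← add_div, le_div_iff₀ hγ']
  -- The self-bounding inequality for `δ` yields `(1 + γ) * LQ * ε` where `2 * LQ * ε` is allowed;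
  -- this is the slack.
  have := mul_nonneg (mul_nonneg hγ'.le hLQ) hε
  nlinarith

end Kernel

/-- Telescoping of a discounted sum along a sequence of approximate potentials. -/
lemma tsum_pow_mul_le_of_potential {γ M e : ℝ} (hγ0 : 0 ≤ γ) (hγ1 : γ < 1) {a b : ℕ → ℝ}
    (ha : ∀ t, |a t| ≤ M) {M' : ℝ} (hb : ∀ t, |b t| ≤ M')
    (h : ∀ t, a t + γ * b (t + 1) ≤ b t + e) :
    ∑' t, γ ^ t * a t ≤ b 0 + e / (1 - γ) := by
  have hγ' : 0 < 1 - γ := by linarith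
  -- The shift solves `C = e + γ * C`, turning the approximate potential into an exact one.
  set b' : ℕ → ℝ := fun t => b t + e / (1 - γ) with hb'
  have hstep : ∀ t, a t + γ * b' (t + 1) ≤ b' t := by
    intro t
    have h1 := h t
    have h2 : e / (1 - γ) = e + γ * (e / (1 - γ)) := by field_simp; ring
    simp only [hb']
    linarith
  have hsum : ∀ n, ∑ t ∈ Finset.range n, γ ^ t * a t + γ ^ n * b' n ≤ b' 0 := by
    intro n
    induction n with
    | zero => simp
    | succ n ih =>
      rw [Finset.sum_range_succ]
      have := mul_le_mul_of_nonneg_left (hstep n) (pow_nonneg hγ0 n)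
      rw [pow_succ]
      linarith
  have hlim : Filter.Tendsto (fun n => γ ^ n * b' n) Filter.atTop (nhds 0) := by
    refine (summable_pow_mul_of_bounded hγ0 hγ1 (M := M' + |e / (1 - γ)|)
      fun t => ?_).tendsto_atTop_zero
    exact (abs_add_le _ _).trans (add_le_add (hb t) le_rfl)
  have := (summable_pow_mul_of_bounded hγ0 hγ1 ha).hasSum.tendsto_sum_nat.add hlim
  rw [add_zero] at this
  exact le_of_tendsto' this hsum

/-! ### The system with `N` agents compared with the mean field. -/

section Agents

variable {X U : Type*} {N : ℕ}

lemma sum_ite_ne_zero [DecidableEq X] {x : Fin N → X} {y : X} (hy : ∃ j, x j = y) :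
    (∑ j, if x j = y then (1 : ℝ) else 0) ≠ 0 := by
  obtain ⟨j, hj⟩ := hy
  refine (lt_of_lt_of_le zero_lt_one ?_).ne'
  refine le_trans ?_ (Finset.single_le_sum
    (f := fun j => if x j = y then (1 : ℝ) else 0) (fun i _ => ?_) (Finset.mem_univ j))
  · simp [hj]
  · split_ifs <;> norm_num

variable [Fintype U] [NeZero N]

lemma exists_isEmpiricalPolicy (x : Fin N → X) (u : Fin N → U) :
    ∃ h : LocalPolicy X U, IsEmpiricalPolicy x u h := by
  classical
  have : ∀ y : X, ∃ p : Prob U, (∃ j, x j = y) → ∀ a,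
      p.1 a = (∑ j, if x j = y ∧ u j = a then (1 : ℝ) else 0)
        / ∑ j, if x j = y then (1 : ℝ) else 0 := by
    intro y
    by_cases hy : ∃ j, x j = y
    · have hpos := sum_ite_ne_zero hy
      refine ⟨⟨fun a => (∑ j, if x j = y ∧ u j = a then (1 : ℝ) else 0)
        / ∑ j, if x j = y then (1 : ℝ) else 0, fun a => ?_, ?_⟩, fun _ a => rfl⟩
      · refine div_nonneg (Finset.sum_nonneg fun j _ => ?_) (Finset.sum_nonneg fun j _ => ?_) <;>
          split_ifs <;> norm_num
      · rw [← Finset.sum_div, Finset.sum_comm, div_eq_one_iff_eq hpos]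
        refine Finset.sum_congr rfl fun j _ => ?_
        by_cases hj : x j = y <;> simp [hj]
    -- At unoccupied states any law will do; `u 0` exists since `N` is nonzero.
    · exact ⟨dirac (u 0), fun h => absurd h hy⟩
  choose h hh using this
  exact ⟨h, fun y hy a => by rw [hh y hy a]⟩

variable [Fintype X] {P : X → Prob X → U → Prob U → Prob X} {rt : X → Prob X → U → Prob U → ℝ}
  {LP R Lrt γ : ℝ}

/-- The conditional mean of the next empirical distribution of the states. -/
def meanNext (P : X → Prob X → U → Prob U → Prob X) (x : Fin N → X) (u : Fin N → U) : Prob X :=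
  avgProb fun j => P (x j) (empirical x) (u j) (empirical u)

/-- The weight `μᴺ(y) hᴺ(y)(a)` is the fraction of agents in state `y` with action `a`. Unoccupied
states have weight zero, so the arbitrary values of `h` there do not matter. This makes the next
three identities exact for every finite `N`. -/
lemma IsEmpiricalPolicy.expect_eq {x : Fin N → X} {u : Fin N → U} {h : LocalPolicy X U}
    (hh : IsEmpiricalPolicy x u h) (g : X → U → ℝ) :
    expect (empirical x) (fun y => expect (h y) (g y)) = (∑ j, g (x j) (u j)) / N := by
  classical
  have key : ∀ y a, (empirical x).1 y * (h y).1 a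
      = (∑ j, if x j = y ∧ u j = a then (1 : ℝ) else 0) / N := by
    intro y a
    by_cases hy : ∃ j, x j = y
    · have hpos := sum_ite_ne_zero hy
      rw [hh y hy a]
      simp only [empirical]
      field_simp
    · have hy' : ∀ j, x j ≠ y := fun j hj => hy ⟨j, hj⟩
      simp [empirical, hy']
  calc expect (empirical x) (fun y => expect (h y) (g y))
      = ∑ y, ∑ a, (empirical x).1 y * (h y).1 a * g y a := by
        simp only [expect, Finset.mul_sum, mul_assoc]
    _ = (∑ y, ∑ a, ∑ j, (if x j = y ∧ u j = a then (1 : ℝ) else 0) * g y a) / N := by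
        simp only [key, div_mul_eq_mul_div, ← Finset.sum_div, Finset.sum_mul]
    _ = (∑ j, ∑ y, ∑ a, (if x j = y ∧ u j = a then (1 : ℝ) else 0) * g y a) / N := by
        congr 1
        rw [Finset.sum_comm]
        conv_lhs => enter [2, a]; rw [Finset.sum_comm]
        rw [Finset.sum_comm]
        exact Finset.sum_congr rfl fun j _ => Finset.sum_comm
    _ = (∑ j, g (x j) (u j)) / N := by
        congr 1
        refine Finset.sum_congr rfl fun j _ => ?_
        rw [Finset.sum_eq_single (x j)]
        · simp
        · intro y _ hy
          simp [hy.symm]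
        · simp

lemma IsEmpiricalPolicy.actionDist_eq {x : Fin N → X} {u : Fin N → U} {h : LocalPolicy X U}
    (hh : IsEmpiricalPolicy x u h) : actionDist (empirical x) h = empirical u := by
  rw [empirical_eq_avgProb u]
  refine Subtype.ext <| funext fun b => ?_
  have := hh.expect_eq fun _ a => (dirac a).1 b
  rw [actionDist, mix_apply]
  simp only [← mix_apply, mix_dirac] at this
  exact this

lemma IsEmpiricalPolicy.aggReward_eq {x : Fin N → X} {u : Fin N → U} {h : LocalPolicy X U}
    (hh : IsEmpiricalPolicy x u h) : aggReward rt (empirical x, h) = avgReward rt x u := by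
  rw [aggReward_eq_expect]
  simp only [hh.actionDist_eq]
  exact hh.expect_eq fun y a => rt y (empirical x) a (empirical u)

lemma IsEmpiricalPolicy.aggDynamics_eq {x : Fin N → X} {u : Fin N → U} {h : LocalPolicy X U}
    (hh : IsEmpiricalPolicy x u h) : aggDynamics P (empirical x, h) = meanNext P x u := by
  refine Subtype.ext <| funext fun b => ?_
  simp only [aggDynamics, hh.actionDist_eq, mix_apply]
  exact hh.expect_eq fun y a => (P y (empirical x) a (empirical u)).1 b

lemma abs_avgReward_le (hr : RewardRegular rt R Lrt) (x : Fin N → X) (u : Fin N → U) :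
    |avgReward rt x u| ≤ R :=
  abs_sum_div_le_of_le fun _ => hr.1 _ _ _ _

lemma expect_profileLaw_succ (π : Policy X U) (x : Fin N → X) (u : Fin N → U) (t : ℕ)
    (f : (Fin N → X) × (Fin N → U) → ℝ) :
    expect (profileLaw P π x u (t + 1)) f = expect (profileLaw P π x u t) fun s =>
      expect (nextState P s.1 s.2) fun x' =>
        expect (nextAction (π (t + 1)) x') fun u' => f (x', u') := by
  rw [profileLaw]
  simp only [expect_mix, expect_single]

lemma expect_profileLaw_zero (π : Policy X U) (x : Fin N → X) (u : Fin N → U)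
    (f : (Fin N → X) × (Fin N → U) → ℝ) : expect (profileLaw P π x u 0) f = f (x, u) := by
  classical exact expect_single _ _ _

lemma agentQpi_eq (hr : RewardRegular rt R Lrt) (hγ0 : 0 ≤ γ) (hγ1 : γ < 1) (π : Policy X U)
    (x : Fin N → X) (u : Fin N → U) :
    agentQpi P rt γ π x u
      = ∑' t, γ ^ t * expect (profileLaw P π x u t) fun s => avgReward rt s.1 s.2 := by
  rw [(summable_pow_mul_of_bounded hγ0 hγ1 fun t => abs_expect_le (profileLaw P π x u t)
    fun s => abs_avgReward_le hr s.1 s.2).tsum_eq_zero_add]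
  rw [expect_profileLaw_zero, pow_zero, one_mul]
  rfl

lemma abs_agentQpi_le (hr : RewardRegular rt R Lrt) (hγ0 : 0 ≤ γ) (hγ1 : γ < 1) (π : Policy X U)
    (x : Fin N → X) (u : Fin N → U) : |agentQpi P rt γ π x u| ≤ R / (1 - γ) := by
  rw [agentQpi_eq hr hγ0 hγ1]
  exact abs_tsum_pow_mul_le hγ0 hγ1 fun t => abs_expect_le _ fun s => abs_avgReward_le hr _ _

/-- The next empirical distribution of the states concentrates around its mean. -/
lemma expect_nextState_l1dist_le (x : Fin N → X) (u : Fin N → U) :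
    expect (nextState P x u) (fun x' => l1dist (empirical x') (meanNext P x u))
      ≤ √(Fintype.card X) / √N := by
  have := expect_l1dist_avgProb_le (fun j => P (x j) (empirical x) (u j) (empirical u))
    (fun _ => (dirac : X → Prob X))
  simp only [mix_dirac, ← empirical_eq_avgProb] at this
  exact this

/-- The empirical distribution of the actions concentrates around its mean. -/
lemma expect_nextAction_l1dist_le (h : LocalPolicy X U) (x : Fin N → X) :
    expect (nextAction (fun _ => h) x) (fun u => l1dist (empirical u) (actionDist (empirical x) h))
      ≤ √(Fintype.card U) / √N := by
  have := expect_l1dist_avgProb_le (fun j => h (x j)) (fun _ => (dirac : U → Prob U))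
  simp only [mix_dirac, ← empirical_eq_avgProb] at this
  rw [actionDist, mix_empirical]
  exact this

/-- Freezing the action distribution at its mean `ν` costs `LP` times its fluctuation. Afterwards
the transition laws of the agents are independent random vectors in `Prob X`, and their average
concentrates. -/
lemma expect_nextAction_meanNext_le (hP : TransitionRegular P LP) (hLP : 0 ≤ LP)
    (h : LocalPolicy X U) (x : Fin N → X) :
    expect (nextAction (fun _ => h) x)
      (fun u => l1dist (meanNext P x u) (aggDynamics P (empirical x, h)))
      ≤ LP * (√(Fintype.card U) / √N) + √(Fintype.card X) / √N := by
  set ν := actionDist (empirical x) h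
  have hstep : ∀ u : Fin N → U, l1dist (meanNext P x u) (aggDynamics P (empirical x, h))
      ≤ LP * l1dist (empirical u) ν
        + l1dist (avgProb fun j => P (x j) (empirical x) (u j) ν)
          (avgProb fun j => mix (h (x j)) fun a => P (x j) (empirical x) a ν) := by
    intro u
    refine (l1dist_triangle _ (avgProb fun j => P (x j) (empirical x) (u j) ν) _).trans
      (add_le_add (l1dist_avgProb_le fun j => ?_) (le_of_eq ?_))
    · refine (hP _ _ _ _ _ _).trans_eq ?_
      rw [l1dist_self, zero_add]
    · rw [aggDynamics, mix_empirical]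
  refine (expect_mono _ hstep).trans ?_
  rw [expect_add, expect_const_mul]
  exact add_le_add (mul_le_mul_of_nonneg_left (expect_nextAction_l1dist_le h x) hLP)
    (expect_l1dist_avgProb_le (fun j => h (x j)) fun j a => P (x j) (empirical x) a ν)

/-- Once the action distribution is frozen at its mean, the expected average reward equals the
aggregated reward exactly; only the freezing costs anything. -/
lemma le_expect_nextAction_avgReward (hr : RewardRegular rt R Lrt) (hL : 0 ≤ Lrt)
    (h : LocalPolicy X U) (x : Fin N → X) :
    aggReward rt (empirical x, h) - Lrt * (√(Fintype.card U) / √N)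
      ≤ expect (nextAction (fun _ => h) x) fun u => avgReward rt x u := by
  set ν := actionDist (empirical x) h
  have hstep : ∀ u : Fin N → U, (∑ j, rt (x j) (empirical x) (u j) ν) / N
      - Lrt * l1dist (empirical u) ν ≤ avgReward rt x u := by
    intro u
    have := (abs_le.1 (abs_sum_div_le_of_le (N := N)
      (f := fun j => rt (x j) (empirical x) (u j) (empirical u) - rt (x j) (empirical x) (u j) ν)
      (a := Lrt * l1dist (empirical u) ν) fun j => by
        simpa [l1dist_self] using hr.2 (x j) (u j) (empirical x) (empirical x) (empirical u) ν)).1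
    rw [Finset.sum_sub_distrib, sub_div] at this
    rw [avgReward]
    linarith
  refine le_trans ?_ (expect_mono _ hstep)
  rw [expect_sub, expect_const_mul, expect_div_const, expect_sum]
  refine sub_le_sub (le_of_eq ?_)
    (mul_le_mul_of_nonneg_left (expect_nextAction_l1dist_le h x) hL)
  rw [aggReward_eq_expect, expect_empirical]
  congr 1
  exact Finset.sum_congr rfl fun j _ => (expect_indep_apply (fun j => h (x j)) j _).symm

/-- No policy of the agents does better than the mean-field optimum, up to `O(1 / √N)`. -/
theorem agentQpi_le [Nonempty U] (hP : TransitionRegular P LP) (hr : RewardRegular rt R Lrt)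
    (hLP : 0 ≤ LP) (hR : 0 ≤ R) (hL : 0 ≤ Lrt) (hγ0 : 0 < γ) (hγ1 : γ < 1)
    (hγ : γ * (2 * LP + 1) < 1) (π : Policy X U) (x : Fin N → X) (u : Fin N → U) :
    agentQpi P rt γ π x u ≤ avgReward rt x u + γ * optValue P rt γ (meanNext P x u)
      + γ * ((R + 2 * Lrt) / (1 - γ * (2 * LP + 1)) * (√(Fintype.card X) / √N)) / (1 - γ) := by
  set LV := (R + 2 * Lrt) / (1 - γ * (2 * LP + 1)) with hLVdef
  have hLV : 0 ≤ LV := div_nonneg (by positivity) (by linarith)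
  set W : (Fin N → X) × (Fin N → U) → ℝ := fun s =>
    avgReward rt s.1 s.2 + γ * optValue P rt γ (meanNext P s.1 s.2) with hW
  -- Whatever the policy did, the realized profile acts as one local policy, hence is no better than
  -- the mean-field optimum.
  have hWV : ∀ (x' : Fin N → X) (u' : Fin N → U), W (x', u') ≤ optValue P rt γ (empirical x') := by
    intro x' u'
    obtain ⟨h, hh⟩ := exists_isEmpiricalPolicy x' u'
    have := optQ_le_optValue (P := P) hr hγ0 hγ1 (empirical x') h
    rwa [optQ, hh.aggReward_eq, hh.aggDynamics_eq] at this
  have hnext : ∀ (x : Fin N → X) (u : Fin N → U),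
      expect (nextState P x u) (fun x' => optValue P rt γ (empirical x'))
      ≤ optValue P rt γ (meanNext P x u) + LV * (√(Fintype.card X) / √N) := by
    intro x u
    refine (expect_mono (g := fun x' => optValue P rt γ (meanNext P x u)
      + LV * l1dist (empirical x') (meanNext P x u)) _ fun x' => ?_).trans ?_
    · have := (abs_le.1 (abs_optValue_sub_le hP hr hLP hR hL hγ0.le hγ1 hγ
        (empirical x') (meanNext P x u))).2
      linarith
    · rw [expect_add, expect_const, expect_const_mul]
      exact add_le_add le_rfl (mul_le_mul_of_nonneg_left (expect_nextState_l1dist_le x u) hLV)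
  rw [agentQpi_eq hr hγ0.le hγ1]
  have hWb : ∀ s, |W s| ≤ R + γ * (R / (1 - γ)) := fun s => by
    refine (abs_add_le _ _).trans (add_le_add (abs_avgReward_le hr s.1 s.2) ?_)
    rw [abs_mul, abs_of_pos hγ0]
    exact mul_le_mul_of_nonneg_left (abs_optValue_le hr hγ0.le hγ1 _) hγ0.le
  have := tsum_pow_mul_le_of_potential hγ0.le hγ1
    (a := fun t => expect (profileLaw P π x u t) fun s => avgReward rt s.1 s.2)
    (b := fun t => expect (profileLaw P π x u t) W)
    (e := γ * (LV * (√(Fintype.card X) / √N)))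
    (fun t => abs_expect_le _ fun s => abs_avgReward_le hr s.1 s.2)
    (fun t => abs_expect_le _ hWb) fun t => by
      rw [expect_profileLaw_succ, ← expect_const_mul, ← expect_add,
        ← expect_const (profileLaw P π x u t) (γ * (LV * _)), ← expect_add]
      refine expect_mono _ fun s => ?_
      have h1 : (expect (nextState P s.1 s.2) fun x' =>
          expect (nextAction (π (t + 1)) x') fun u' => W (x', u'))
          ≤ optValue P rt γ (meanNext P s.1 s.2) + LV * (√(Fintype.card X) / √N) :=
        (expect_mono _ fun x' => expect_le_of_le _ fun u' => hWV x' u').trans (hnext s.1 s.2)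
      have h2 := mul_le_mul_of_nonneg_left h1 hγ0.le
      simp only [hW] at h2 ⊢
      linarith
  rwa [expect_profileLaw_zero] at this

/-- Open-loop controls, applied by all agents, do as well for the agents as for the mean field, up
to `O(1 / √N)`. -/
theorem le_agentQpi_openLoop (hP : TransitionRegular P LP) (hr : RewardRegular rt R Lrt)
    (hLP : 0 ≤ LP) (hR : 0 ≤ R) (hL : 0 ≤ Lrt) (hγ0 : 0 < γ) (hγ1 : γ < 1)
    (hγ : γ * (2 * LP + 1) < 1) (h : ℕ → LocalPolicy X U) (x : Fin N → X) (u : Fin N → U) :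
    avgReward rt x u + γ * openLoopValue P rt γ (meanNext P x u) h
      - γ * ((R + 2 * Lrt) / (1 - γ * (2 * LP + 1)) * (√(Fintype.card X) / √N)
        + Lrt * (√(Fintype.card U) / √N)
        + γ * ((R + 2 * Lrt) / (1 - γ * (2 * LP + 1))
          * (LP * (√(Fintype.card U) / √N) + √(Fintype.card X) / √N))) / (1 - γ)
      ≤ agentQpi P rt γ (fun t _ => h (t - 1)) x u := by
  set LV := (R + 2 * Lrt) / (1 - γ * (2 * LP + 1)) with hLVdef
  have hLV : 0 ≤ LV := div_nonneg (by positivity) (by linarith)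
  set eU := √(Fintype.card U : ℝ) / √N
  set eX := √(Fintype.card X : ℝ) / √N
  -- The actions at time `0` are prescribed, so the controls start at time `1`: `π (t + 1)` is `h
  -- t`. The value at `0` plays no role.
  set π : Policy X U := fun t _ => h (t - 1)
  have hlip : ∀ (h : ℕ → LocalPolicy X U) μ μ', openLoopValue P rt γ μ' h - LV * l1dist μ μ'
      ≤ openLoopValue P rt γ μ h := fun h μ μ' => by
    have := (abs_le.1 (abs_openLoopValue_sub_le hP hr hLP hR hL hγ0.le hγ1 hγ μ μ' h)).1
    linarith
  set W : ℕ → (Fin N → X) × (Fin N → U) → ℝ := fun t s =>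
    avgReward rt s.1 s.2 + γ * openLoopValue P rt γ (meanNext P s.1 s.2) (fun n => h (n + t))
    with hW
  have hact : ∀ t (x' : Fin N → X), openLoopValue P rt γ (empirical x') (fun n => h (n + t))
      - (Lrt * eU + γ * (LV * (LP * eU + eX)))
      ≤ expect (nextAction (π (t + 1)) x') fun u' => W (t + 1) (x', u') := by
    intro t x'
    have hπ : π (t + 1) = fun _ => h t := rfl
    rw [hπ]
    simp only [hW]
    rw [expect_add, expect_const_mul, openLoopValue_eq hr hγ0.le hγ1]
    have h1 := le_expect_nextAction_avgReward hr hL (h t) x'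
    have h2 : openLoopValue P rt γ (aggDynamics P (empirical x', h t)) (fun n => h (n + (t + 1)))
        - LV * (LP * eU + eX)
        ≤ expect (nextAction (fun _ => h t) x') fun u' =>
          openLoopValue P rt γ (meanNext P x' u') fun n => h (n + (t + 1)) := by
      refine le_trans ?_ (expect_mono _ fun u' => hlip _ _ (aggDynamics P (empirical x', h t)))
      rw [expect_sub, expect_const, expect_const_mul]
      exact sub_le_sub le_rfl
        (mul_le_mul_of_nonneg_left (expect_nextAction_meanNext_le hP hLP (h t) x') hLV)
    have h3 := mul_le_mul_of_nonneg_left h2 hγ0.le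
    simp only [zero_add, add_assoc, add_comm 1 t] at h1 h3 ⊢
    linarith
  have hnext : ∀ t (x : Fin N → X) (u : Fin N → U),
      openLoopValue P rt γ (meanNext P x u) (fun n => h (n + t)) - LV * eX
        ≤ expect (nextState P x u) fun x' =>
        openLoopValue P rt γ (empirical x') fun n => h (n + t) := by
    intro t x u
    refine le_trans ?_ (expect_mono _ fun x' => hlip _ _ (meanNext P x u))
    rw [expect_sub, expect_const, expect_const_mul]
    exact sub_le_sub le_rfl (mul_le_mul_of_nonneg_left (expect_nextState_l1dist_le x u) hLV)
  have hWb : ∀ t s, |W t s| ≤ R + γ * (R / (1 - γ)) := fun t s => by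
    refine (abs_add_le _ _).trans (add_le_add (abs_avgReward_le hr s.1 s.2) ?_)
    rw [abs_mul, abs_of_pos hγ0]
    exact mul_le_mul_of_nonneg_left (abs_openLoopValue_le hr hγ0.le hγ1 _ _) hγ0.le
  rw [agentQpi_eq hr hγ0.le hγ1]
  -- The telescoping bound is one-sided; applied to the negated sequences it gives the lower bound.
  have := tsum_pow_mul_le_of_potential hγ0.le hγ1
    (a := fun t => -expect (profileLaw P π x u t) fun s => avgReward rt s.1 s.2)
    (b := fun t => -expect (profileLaw P π x u t) (W t))
    (e := γ * (LV * eX + Lrt * eU + γ * (LV * (LP * eU + eX))))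
    (fun t => (abs_neg _).trans_le (abs_expect_le _ fun s => abs_avgReward_le hr s.1 s.2))
    (fun t => (abs_neg _).trans_le (abs_expect_le _ (hWb t))) fun t => by
      have hmain : expect (profileLaw P π x u t) (W t)
          - γ * (LV * eX + Lrt * eU + γ * (LV * (LP * eU + eX)))
          ≤ (expect (profileLaw P π x u t) fun s => avgReward rt s.1 s.2)
            + γ * expect (profileLaw P π x u (t + 1)) (W (t + 1)) := by
        rw [expect_profileLaw_succ, ← expect_const_mul, ← expect_add,
          ← expect_const (profileLaw P π x u t) (γ * (LV * eX + _ + _)), ← expect_sub]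
        refine expect_mono _ fun s => ?_
        have h1 := expect_mono (nextState P s.1 s.2) (hact t)
        rw [expect_sub, expect_const] at h1
        have h2 := hnext t s.1 s.2
        have h3 := mul_le_mul_of_nonneg_left ((sub_le_sub_right h2 _).trans h1) hγ0.le
        simp only [hW] at h3 ⊢
        linarith
      linarith
  simp only [mul_neg, tsum_neg, expect_profileLaw_zero] at this
  simp only [hW, add_zero] at this
  linarith

/-- The optimal value of the `N` agents is that of the mean field, up to `O(1 / √N)`. -/
theorem abs_agentQ_sub_optQ_le [Nonempty U] (hP : TransitionRegular P LP)
    (hr : RewardRegular rt R Lrt) (hLP : 0 ≤ LP) (hR : 0 ≤ R) (hL : 0 ≤ Lrt) (hγ0 : 0 < γ)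
    (hγ1 : γ < 1) (hγ : γ * (2 * LP + 1) < 1) {A : Set (Policy X U)} {LPi : ℝ} (hLPi : 0 ≤ LPi)
    (hA : lipAdmissible X U LPi ⊆ A) {x : Fin N → X} {u : Fin N → U} {h : LocalPolicy X U}
    (hh : IsEmpiricalPolicy x u h) :
    |agentQ P rt γ A x u - optQ P rt γ (empirical x, h)|
      ≤ ((R + 2 * Lrt) / (1 - γ * (2 * LP + 1)) * (2 + LP) + Lrt) / (1 - γ)
        * (√(Fintype.card X) + √(Fintype.card U)) / √N := by
  have hγ' : 0 < 1 - γ := by linarith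
  have hup := agentQpi_le (N := N) hP hr hLP hR hL hγ0 hγ1 hγ
  have hlow := le_agentQpi_openLoop (N := N) hP hr hLP hR hL hγ0 hγ1 hγ
  set LV := (R + 2 * Lrt) / (1 - γ * (2 * LP + 1)) with hLVdef
  have hLV : 0 ≤ LV := div_nonneg (by positivity) (by linarith)
  rw [mul_div_assoc, add_div (√(Fintype.card X : ℝ))]
  set eU := √(Fintype.card U : ℝ) / √N
  set eX := √(Fintype.card X : ℝ) / √N
  have heU : 0 ≤ eU := by positivity
  have heX : 0 ≤ eX := by positivity
  rw [optQ, hh.aggReward_eq, hh.aggDynamics_eq]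
  set E := (LV * (2 + LP) + Lrt) / (1 - γ) * (eX + eU) with hE
  -- A policy constant in the state distribution is measurable and satisfies any nonnegative
  -- Lipschitz bound.
  have hmem : ∀ h' : ℕ → LocalPolicy X U, (fun t _ => h' (t - 1) : Policy X U) ∈ A := fun h' =>
    hA ⟨fun t => measurable_const, fun t x μ₁ μ₂ => by
      rw [l1dist_self]
      exact mul_nonneg hLPi (l1dist_nonneg _ _)⟩
  have hEup : γ * (LV * eX) / (1 - γ) ≤ E := by
    rw [hE, div_mul_eq_mul_div _ (1 - γ)]
    refine div_le_div_of_nonneg_right ?_ hγ'.le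
    calc γ * (LV * eX) ≤ 1 * (LV * eX) := by gcongr
      _ ≤ (LV * (2 + LP) + Lrt) * (eX + eU) := by
        have : 0 ≤ LV * eX + LV * LP * eX + Lrt * eX + (LV * (2 + LP) + Lrt) * eU := by positivity
        linarith
  have hElow : γ * (LV * eX + Lrt * eU + γ * (LV * (LP * eU + eX))) / (1 - γ) ≤ E := by
    rw [hE, div_mul_eq_mul_div _ (1 - γ)]
    refine div_le_div_of_nonneg_right ?_ hγ'.le
    calc γ * (LV * eX + Lrt * eU + γ * (LV * (LP * eU + eX)))
        ≤ 1 * (LV * eX + Lrt * eU + 1 * (LV * (LP * eU + eX))) := by gcongr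
      _ ≤ (LV * (2 + LP) + Lrt) * (eX + eU) := by
        have : 0 ≤ LV * LP * eX + Lrt * eX + 2 * LV * eU := by positivity
        linarith
  have hne : Nonempty A := ⟨⟨_, hmem (Classical.arbitrary _)⟩⟩
  have hbdd : BddAbove (Set.range fun π : A => agentQpi P rt γ π.1 x u) := ⟨R / (1 - γ), by
    rintro _ ⟨π, rfl⟩
    exact (abs_le.1 (abs_agentQpi_le hr hγ0.le hγ1 π.1 x u)).2⟩
  rw [abs_le]
  constructor
  -- Solved for the optimal value, so that the supremum over open-loop controls is bounded one
  -- control at a time.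
  · have : optValue P rt γ (meanNext P x u)
        ≤ (agentQ P rt γ A x u + E - avgReward rt x u) / γ := by
      refine ciSup_le fun h' => ?_
      rw [le_div_iff₀ hγ0]
      have h1 := hlow h' x u
      have h2 : agentQpi P rt γ (fun t _ => h' (t - 1)) x u ≤ agentQ P rt γ A x u :=
        le_ciSup hbdd ⟨_, hmem h'⟩
      linarith
    rw [le_div_iff₀ hγ0] at this
    linarith
  · have : agentQ P rt γ A x u
        ≤ avgReward rt x u + γ * optValue P rt γ (meanNext P x u) + E :=
      ciSup_le fun π => (hup π.1 x u).trans (add_le_add le_rfl hEup)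
    linarith

end Agents

end MFC

end

/-! ### The main theorem. -/

theorem mainTheorem2 (LP LPi R Lrt γ : ℝ) (hLP : 0 < LP) (hLPi : 0 < LPi) (hR : 0 < R)
    (hLrt : 0 < Lrt) (hγ0 : 0 < γ) (hγ1 : γ < 1) (hγ : γ * (2 * LP + 1) * (1 + LPi) < 1) :
    -- the constant is `C₀ * (√|X| + √|U|)`
    ∃ C₀ : ℝ, 0 < C₀ ∧
      ∀ (X U : Type*) [Fintype X] [Nonempty X] [Fintype U] [Nonempty U]
        (P : X → MFC.Prob X → U → MFC.Prob U → MFC.Prob X)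
        (rt : X → MFC.Prob X → U → MFC.Prob U → ℝ),
        MFC.TransitionRegular P LP → MFC.RewardRegular rt R Lrt →
      ∀ (ε : ℝ), 0 < ε →
      ∀ (net : Finset (MFC.Lifted X U)), MFC.IsNet ε net →
      ∀ (K : net → MFC.Lifted X U → ℝ) (NK : ℕ) (LK : ℝ), 0 < LK →
        MFC.IsRegressionKernel ε net K NK LK →
      ∀ (rhat : net → ℝ) (Φhat : net → MFC.Prob X),
        (∀ i, MFC.IsSampledFrom P rt ε i.1 (rhat i) (Φhat i)) →
      ∃ Qhat : net → ℝ,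
        -- `Qhat` is the unique fixed point, in the ball of radius `V_max = R / (1 - γ)`
        ((∀ i, |Qhat i| ≤ R / (1 - γ)) ∧ MFC.bellmanHat γ K rhat Φhat Qhat = Qhat ∧
          ∀ q : net → ℝ, (∀ i, |q i| ≤ R / (1 - γ)) → MFC.bellmanHat γ K rhat Φhat q = q →
            q = Qhat) ∧
        ∀ (N : ℕ) [NeZero N] (A : Set (MFC.Policy X U)),
          MFC.lipAdmissible X U LPi ⊆ A → A ⊆ MFC.admissible X U →
        ∀ (x : Fin N → X) (u : Fin N → U) (h : MFC.LocalPolicy X U), MFC.IsEmpiricalPolicy x u h →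
          |MFC.agentQ P rt γ A x u - MFC.kernelReg K Qhat (MFC.empirical x, h)| ≤
            ((R + 2 * Lrt) + 2 * γ * NK * LK * (R / (1 - γ)) * (2 * LP + 1)) / (1 - γ) * ε
            + 2 * (R + 2 * Lrt) / ((1 - γ * (2 * LP + 1)) * (1 - γ)) * ε
            + C₀ * (√(Fintype.card X) + √(Fintype.card U)) / √N := by
  have hγ' : γ * (2 * LP + 1) < 1 := by
    have : 0 < γ * (2 * LP + 1) * LPi := by positivity
    linarith
  have h1 : 0 < 1 - γ := by linarith
  have h2 : 0 < 1 - γ * (2 * LP + 1) := by linarith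
  -- The constant of `abs_agentQ_sub_optQ_le`, chosen before the spaces, the net and `N`.
  refine ⟨((R + 2 * Lrt) / (1 - γ * (2 * LP + 1)) * (2 + LP) + Lrt) / (1 - γ), by positivity, ?_⟩
  intro X U _ _ _ _ P rt hP hr ε _ net hnet K NK LK hLK hK rhat Φhat hs
  have hcontr := MFC.contracting_bellmanHat (rhat := rhat) (Φhat := Φhat) hK hγ0.le hγ1
  have hfix : MFC.bellmanHat γ K rhat Φhat (ContractingWith.fixedPoint _ hcontr)
    = ContractingWith.fixedPoint _ hcontr := hcontr.fixedPoint_isFixedPt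
  refine ⟨ContractingWith.fixedPoint _ hcontr, ⟨MFC.abs_le_of_bellmanHat_eq hK hγ0.le hγ1
    (fun i => (hs i).abs_le hr) hfix, hfix, fun q _ hq => hcontr.fixedPoint_unique hq⟩, ?_⟩
  intro N _ A hA _ x u h hh
  -- The mean-field value `optQ` is the intermediate point: the agent error is `O(1 / √N)`, the
  -- kernel error `O(ε)`.
  refine (abs_sub_le _ (MFC.optQ P rt γ (MFC.empirical x, h)) _).trans ?_
  rw [add_comm]
  exact add_le_add
    (MFC.abs_optQ_sub_kernelReg_le hP hr hLP.le hR.le hLrt.le hγ0 hγ1 hγ' hnet hK hLK.le hs hfix _)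
    (MFC.abs_agentQ_sub_optQ_le hP hr hLP.le hR.le hLrt.le hγ0 hγ1 hγ' hLPi.le hA hh)
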